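/- Let $\mathfrak M$ be a matchbox manifold, that is, a compact connected metric space with a smooth foliated structure whose transverse model is totally disconnected. Its leaves are its path components, and it carries a leafwise Riemannian metric with leafwise length distance $d_{\mathcal F}$ (infinite between different leaves). Assume that it is minimal (every leaf is dense). Fix a finite regular foliated covering by charts $\varphi_i:\overline U_i\to[-1,1]^n\times\mathfrak T_i$, where $\mathfrak X=\mathfrak T_1\sqcup\dots\sqcup\mathfrak T_\nu$ is a compact totally disconnected space with clopen pieces $\mathfrak T_i$; put $U_i=\varphi_i^{-1}((-1,1)^n\times\mathfrak T_i)$ and $\tau(w)=\varphi_i^{-1}(0,w)$ for $w\in\mathfrak T_i$. "Regular" means: with constants $\lambda_{\mathcal F}>0$ and $0<\delta_{\mathcal U}^{\mathcal F}<\lambda_{\mathcal F}/5$, each $\overline U_i$ lies in a ball of a prescribed radius $\epsilon_{\mathfrak M}$ around a point of $\tau(\mathfrak T_i)$; the closed leafwise balls of radius $\lambda_{\mathcal F}$ and the plaques $\varphi_i^{-1}([-1,1]^n\times\{w\})$ are strongly convex; the plaque of $w$ contains the closed leafwise ball of radius $\delta_{\mathcal U}^{\mathcal F}/2$ and lies in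 the one of radius $\delta_{\mathcal U}^{\mathcal F}$ around $\tau(w)$; the projections of $U_i\cap U_j$ to $\mathfrak T_i$ are clopen; each plaque of $U_i$ meets at most one plaque of $U_j$; $\tau$ is injective, and $d_{\mathfrak X}$ is the distance of $\mathfrak M$ pulled back by $\tau$. Let $\epsilon_{\mathcal U}>0$ be a Lebesgue number of $\{U_i\}$ and let $\epsilon^{\mathcal F}_{\mathcal U}>0$ be such that every closed leafwise ball of radius $\epsilon^{\mathcal F}_{\mathcal U}$ lies in the closed ball of $\mathfrak M$ of radius $\epsilon_{\mathcal U}/4$ with the same center. For a sequence $I=(i_0,\dots,i_k)$ of length $k$, let $h_I$ be the holonomy map, the composition of the transverse changes of coordinates, with its maximal domain $\mathrm{Dom}(h_I)\subset\mathfrak T_{i_0}$. The leaf through $\tau(w)$ is without holonomy if every $h_I$ with $h_I(w)=w$ is the identity near $w$. A path $\gamma:[0,1]\to\mathfrak M$ is covered by $(I,w)$ if for some $0=s_0<\dots<s_k=1$, $\gamma([s_l,s_{l+1}])$ lies in the plaque of $h_{(i_0,\dots,i_l)}(w)$ in $\overline U_{i_l}$ for all $0\le l<k$, and $\gamma(1)$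 lies in the plaque of $h_I(w)$ in $\overline U_{i_k}$. Let $L_w$ be the leaf of $\tau(w)$, and for $w_0\in\mathfrak X$ let $\lambda_1(\delta;w_0)\in[0,\infty]$ be the infimum, over all open $W\ni w_0$ with $\mathrm{diam}\,W\le\delta$ and all $w\in W$, of the largest $\lambda$ such that $L_w\cap\tau(W)$ is $\lambda$-separated for $d_{\mathcal F}$; put $\lambda_1(\delta)=\inf_{w\in\mathfrak X}\lambda_1(\delta;w)$. Let $\epsilon_H>0$, and let $\delta^*(V,\alpha)>0$ be any prescribed positive function of a subset $V\subset\mathfrak X$ and an integer $\alpha\ge0$. Let $w_0\in\mathfrak T_1$ be such that its leaf $L_0=L_{w_0}$ is without holonomy. Then for all $\ell\ge1$ there exist the following. 1. Clopen neighborhoods $w_0\in V_\ell\subset V_{\ell-1}\subset\dots\subset V_1\subset\mathfrak T_1$ with $\mathrm{diam}(V_\ell)<\epsilon_H/2^\ell$. 2. Constants $0<\epsilon_\ell\le\epsilon_H$ with $\mathrm{diam}(V_\ell)<\epsilon_\ell$ and $\epsilon_{\ell+1}<\epsilon_\ell/2$; integers $\alpha_\ell$ such that the sets $h_I(V_\ell)$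 with $I$ of length at most $\alpha_\ell$ cover $\mathfrak X$; $\theta_\ell=(2\alpha_\ell+1)\delta^{\mathcal F}_{\mathcal U}$, $R'_\ell=2\theta_\ell+\lambda_{\mathcal F}$, $R_\ell=2R'_\ell$, $\widehat\beta_\ell=\lceil R_\ell/\epsilon^{\mathcal F}_{\mathcal U}\rceil$; a number $0<e_\ell\le\min\{\epsilon_H,\delta^*(V_\ell,\alpha_\ell)\}$ with $e_\ell<d_{\mathfrak X}(x,y)$ for all $x\in V_\ell$, $y\notin V_\ell$; and $0<\widehat\delta_\ell\le e_\ell$ such that for every $I$ of length at most $\widehat\beta_\ell+1$ and every $w\in\mathrm{Dom}(h_I)$, the closed $\widehat\delta_\ell$-ball around $w$ lies in $\mathrm{Dom}(h_I)$ and is mapped by $h_I$ into the closed $e_\ell$-ball around $h_I(w)$. Moreover $\lambda_1(\epsilon_{\ell+1};w_0)>R_\ell$, and if all the leaves are without holonomy then also $\lambda_1(\epsilon_{\ell+1})>R_\ell$. 3. The net $\mathcal N_\ell=L_0\cap\tau(V_\ell)$ is $\lambda_1(\epsilon_\ell;w_0)$-separated and is $\theta_\ell$-dense in $L_0$. 4.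 A partition of $V_\ell$ into nonempty clopen sets $W(\ell;i)$, $1\le i\le\kappa_\ell$, of diameter less than $\widehat\delta_\ell$. Every piecewise $C^1$ leafwise path of length at most $R_\ell$ from $\tau(w)$ to $\tau(w')$ with $w,w'\in V_\ell$ is covered by some $(I,w)$ with $I$ of length at most $\widehat\beta_\ell+1$ and $h_I(w)=w'$; and whenever $w\in W(\ell;i)$ and $(I,w)$ with $I$ of length at most $\widehat\beta_\ell+1$ covers such a path, where $w'=h_I(w)$, then $W(\ell;i)\subset\mathrm{Dom}(h_I)$ and $h_I(W(\ell;i))\subset V_\ell$. The code of $u\in W(\ell;i)$ along $I$ is the index $m$ with $h_I(u)\in W(\ell;m)$; "codes along paths of length at most $R$" ($R\le R_\ell$) are the codes along all such $I$, for all $w\in W(\ell;i)$, that cover a path of length at most $R$. 5. A partition of each $W(\ell;i)$ into nonempty clopen sets $V(\ell;i,j)$, $1\le j\le\kappa_{\ell,i}$, with $\mathrm{diam}(V(\ell;i,j))<\min\{\widehat\delta_\ell,\epsilon_H/4^\ell\}$, such that on each $V(\ell;i,j)$ the codes along paths of length at most $R'_\ell$ are constant, while points of different $V(\ell;i,j)$,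 $V(\ell;i,j')$ have different codes. 6. A partition of each $V(\ell;i,j)$ into nonempty clopen sets $V(\ell;i,j,k)$, $1\le k\le\kappa_{\ell,i,j}$, such that on each $V(\ell;i,j,k)$ the codes along paths of length at most $R_\ell=2R'_\ell$ are constant, while points of different $V(\ell;i,j,k)$, $V(\ell;i,j,k')$ have different codes. The set $V_{\ell+1}$ is contained in the set $V(\ell;i,j,k)$ that contains $w_0$. -/

import Mathlib

open Set Topology
open scoped ENNReal ContDiff

namespace Matchbox

/-- The open cube `(-r, r)^n` in `ℝ^n`. -/
def openCube (n : ℕ) (r : ℝ) : Set (Fin n → ℝ) := Set.univ.pi fun _ => Ioo (-r) r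

/-- The closed cube `[-1, 1]^n` in `ℝ^n`. -/
def closedCube (n : ℕ) : Set (Fin n → ℝ) := Set.univ.pi fun _ => Icc (-1) 1

/-- A function of the variables `(y, w)` (leaf coordinate, transverse coordinate) on an open set `O`
is leafwise smooth: it is `C^∞` in `y`, and all its `y`-derivatives are continuous in `(y, w)`
(so that it depends continuously on `w` in the `C^∞` topology). -/
def LeafSmooth {n : ℕ} {X F : Type*} [TopologicalSpace X] [NormedAddCommGroup F] [NormedSpace ℝ F]
    (O : Set ((Fin n → ℝ) × X)) (f : (Fin n → ℝ) × X → F) : Prop :=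
  (∀ p ∈ O, ContDiffAt ℝ ∞ (fun y => f (y, p.2)) p.1) ∧
    ∀ k : ℕ, ContinuousOn (fun p : (Fin n → ℝ) × X =>
      iteratedFDeriv ℝ k (fun y => f (y, p.2)) p.1) O

/-- A finite smooth foliated atlas with `ν` charts and leaf dimension `n` on `M`, with transverse
space `X`, the disjoint union of the clopen sets `T i = {w | idx w = i}`.
The chart `chart i` is the extended chart, a homeomorphism of an open set onto `(-2,2)^n × T i`.
When `X` is totally disconnected, the transverse component of a change of coordinates is locally
constant along plaques, so that the extended charts are automatically foliated. -/
structure Atlas (n ν : ℕ) (M X : Type*) [TopologicalSpace M] [TopologicalSpace X] where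
  idx : X → Fin ν
  continuous_idx : Continuous idx
  chart : Fin ν → OpenPartialHomeomorph M ((Fin n → ℝ) × X)
  target_chart : ∀ i, (chart i).target = openCube n 2 ×ˢ {w | idx w = i}
  covers : ∀ z : M, ∃ i, z ∈ (chart i).source ∧ (chart i z).1 ∈ openCube n 1
  smooth : ∀ i j, LeafSmooth
    {p | p ∈ (chart i).target ∧ p.1 ∈ openCube n 1 ∧ (chart i).symm p ∈ (chart j).source ∧
      (chart j ((chart i).symm p)).1 ∈ openCube n 1}
    (fun p => (chart j ((chart i).symm p)).1)

namespace Atlas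

variable {n ν : ℕ} {M X : Type*} [TopologicalSpace M] [TopologicalSpace X]

/-- The local transverse model `𝔗_i`, a clopen subset of `X`. -/
def T (A : Atlas n ν M X) (i : Fin ν) : Set X := {w | A.idx w = i}

/-- The foliation chart `U_i = φ_i⁻¹((-1,1)^n × 𝔗_i)`. -/
def U (A : Atlas n ν M X) (i : Fin ν) : Set M :=
  {z | z ∈ (A.chart i).source ∧ (A.chart i z).1 ∈ openCube n 1}

/-- Its closure `φ_i⁻¹([-1,1]^n × 𝔗_i)`. -/
def Ubar (A : Atlas n ν M X) (i : Fin ν) : Set M :=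
  {z | z ∈ (A.chart i).source ∧ (A.chart i z).1 ∈ closedCube n}

/-- The closed plaque `P_i(w) = φ_i⁻¹([-1,1]^n × {w})`. -/
def plaque (A : Atlas n ν M X) (i : Fin ν) (w : X) : Set M :=
  {z | z ∈ A.Ubar i ∧ (A.chart i z).2 = w}

/-- The section `τ : X → M`, `τ(w) = φ_i⁻¹(0, w)` for `w ∈ 𝔗_i`. -/
def tau (A : Atlas n ν M X) (w : X) : M := (A.chart (A.idx w)).symm (0, w)

/-- The leaf through `x`: leaves of a matchbox manifold are its path components. -/
def leaf (_A : Atlas n ν M X) (x : M) : Set M := pathComponent x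

/-- The domain `𝔗_{i,j} = π_i(U_i ∩ U_j)` of the transverse change of coordinates. -/
def Tij (A : Atlas n ν M X) (i j : Fin ν) : Set X :=
  (fun z => (A.chart i z).2) '' (A.U i ∩ A.U j)

/-- The plaques of `w` in `U_i` and of `w'` in `U_j` meet, that is, the transverse change
of coordinates takes `w` to `w'`. -/
def Meets (A : Atlas n ν M X) (i j : Fin ν) (w w' : X) : Prop :=
  ∃ z ∈ A.U i ∩ A.U j, (A.chart i z).2 = w ∧ (A.chart j z).2 = w'

/-- `(P_{i_0}(w_0), …, P_{i_k}(w_k))` is a plaque chain. -/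
def IsPlaqueChain (A : Atlas n ν M X) {k : ℕ} (I : Fin (k + 1) → Fin ν) (w : Fin (k + 1) → X) :
    Prop :=
  w 0 ∈ A.T (I 0) ∧
    ∀ l : Fin k, A.Meets (I l.castSucc) (I l.succ) (w l.castSucc) (w l.succ)

/-- The domain of the holonomy map `h_I = h_{i_k,i_{k-1}} ∘ ⋯ ∘ h_{i_1,i_0}`: the points for which
all the compositions are defined. -/
def holDom (A : Atlas n ν M X) {k : ℕ} (I : Fin (k + 1) → Fin ν) : Set X :=
  {u | ∃ w, A.IsPlaqueChain I w ∧ w 0 = u}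

open Classical in
/-- The holonomy map `h_I` on its domain `holDom I` (and the identity outside of it). -/
noncomputable def hol (A : Atlas n ν M X) {k : ℕ} (I : Fin (k + 1) → Fin ν) (u : X) : X :=
  if h : u ∈ A.holDom I then h.choose (Fin.last k) else u

/-- The point `w` (equivalently its leaf) is without holonomy: every element of the holonomy
pseudogroup that fixes `w` has the germ of the identity at `w`. -/
def WithoutHolonomy (A : Atlas n ν M X) (w : X) : Prop :=
  ∀ (k : ℕ) (I : Fin (k + 1) → Fin ν), w ∈ A.holDom I → A.hol I w = w → A.hol I =ᶠ[𝓝 w] id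

/-- `X` is covered by the translates of `V` under the holonomy maps of word length at most `α`. -/
def CoveredByTranslates (A : Atlas n ν M X) (V : Set X) (α : ℕ) : Prop :=
  ∀ x : X, ∃ k ≤ α, ∃ I : Fin (k + 1) → Fin ν, ∃ u ∈ V ∩ A.holDom I, A.hol I u = x

/-- `γ` is a piecewise `C¹` leafwise curve from `x` to `y` on the interval `[a, b]`. -/
def IsCurve (A : Atlas n ν M X) (γ : ℝ → M) (a b : ℝ) (x y : M) : Prop :=
  a ≤ b ∧ ContinuousOn γ (Icc a b) ∧ γ a = x ∧ γ b = y ∧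
    ∃ (m : ℕ) (t : Fin (m + 1) → ℝ), Monotone t ∧ t 0 = a ∧ t (Fin.last m) = b ∧
      ∀ l : Fin m, ∃ i : Fin ν, MapsTo γ (Icc (t l.castSucc) (t l.succ)) (A.U i) ∧
        ContDiffOn ℝ 1 (fun s => (A.chart i (γ s)).1) (Icc (t l.castSucc) (t l.succ))

/-- The plaque chain of the sequence `I` that starts at `w` covers the path `γ` on `[0, 1]`. -/
def Covers (A : Atlas n ν M X) {k : ℕ} (I : Fin (k + 1) → Fin ν) (w : X) (γ : ℝ → M) : Prop :=
  ∃ (p : Fin (k + 1) → X) (s : Fin (k + 1) → ℝ), A.IsPlaqueChain I p ∧ p 0 = w ∧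
    StrictMono s ∧ s 0 = 0 ∧ s (Fin.last k) = 1 ∧
    (∀ l : Fin k,
      MapsTo γ (Icc (s l.castSucc) (s l.succ)) (A.plaque (I l.castSucc) (p l.castSucc))) ∧
    γ 1 ∈ A.plaque (I (Fin.last k)) (p (Fin.last k))

end Atlas

/-- A leafwise Riemannian metric: a smooth field of inner products on the leaf directions of every
chart, compatible with the changes of coordinates, and continuous in the transverse direction. -/
structure LeafMetric {n ν : ℕ} {M X : Type*} [TopologicalSpace M] [TopologicalSpace X]
    (A : Atlas n ν M X) where
  g : Fin ν → (Fin n → ℝ) × X → (Fin n → ℝ) →L[ℝ] (Fin n → ℝ) →L[ℝ] ℝ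
  symm : ∀ i, ∀ z ∈ A.U i, ∀ v v', g i (A.chart i z) v v' = g i (A.chart i z) v' v
  pos : ∀ i, ∀ z ∈ A.U i, ∀ v, v ≠ 0 → 0 < g i (A.chart i z) v v
  smooth : ∀ i, LeafSmooth (openCube n 1 ×ˢ A.T i) (g i)
  compat : ∀ i j, ∀ z ∈ A.U i ∩ A.U j, ∀ v v',
    g i (A.chart i z) v v' = g j (A.chart j z)
      (fderiv ℝ (fun y => (A.chart j ((A.chart i).symm (y, (A.chart i z).2))).1)
        (A.chart i z).1 v)
      (fderiv ℝ (fun y => (A.chart j ((A.chart i).symm (y, (A.chart i z).2))).1)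
        (A.chart i z).1 v')

namespace LeafMetric

variable {n ν : ℕ} {M X : Type*} [TopologicalSpace M] [TopologicalSpace X] {A : Atlas n ν M X}

/-- The Riemannian norm of the velocity of the leafwise curve `γ` at time `t`. It is computed in any
chart around `γ t`; all of them give the same value, so the supremum is this value. -/
noncomputable def speed (G : LeafMetric A) (γ : ℝ → M) (t : ℝ) : ℝ≥0∞ :=
  ⨆ (i : Fin ν) (_ : γ t ∈ A.U i), ENNReal.ofReal (Real.sqrt
    (G.g i (A.chart i (γ t)) (deriv (fun s => (A.chart i (γ s)).1) t)
      (deriv (fun s => (A.chart i (γ s)).1) t)))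

/-- The length of the curve `γ` on `[a, b]`. -/
noncomputable def length (G : LeafMetric A) (γ : ℝ → M) (a b : ℝ) : ℝ≥0∞ :=
  ∫⁻ t in Icc a b, G.speed γ t

/-- The leafwise distance `d_F`: the infimum of the lengths of piecewise `C¹` leafwise curves
(infinite for points of different leaves). -/
noncomputable def dF (G : LeafMetric A) (x y : M) : ℝ≥0∞ :=
  ⨅ (γ : ℝ → M) (a : ℝ) (b : ℝ) (_ : A.IsCurve γ a b x y), G.length γ a b

/-- The closed leafwise ball `D_F(x, r)`. -/
def DF (G : LeafMetric A) (x : M) (r : ℝ) : Set M := {y | G.dF x y ≤ ENNReal.ofReal r}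

/-- `c` is a shortest geodesic from `y` to `y'`, parametrized proportionally to arc length. -/
def IsShortestGeodesic (G : LeafMetric A) (c : unitInterval → M) (y y' : M) : Prop :=
  c 0 = y ∧ c 1 = y' ∧
    ∀ s t : unitInterval, G.dF (c s) (c t) = ENNReal.ofReal |(s : ℝ) - t| * G.dF y y'

/-- A subset of a leaf is strongly convex: any two of its points are joined by a unique shortest
geodesic, which stays in the set. -/
def StronglyConvex (G : LeafMetric A) (S : Set M) : Prop :=
  ∀ y ∈ S, ∀ y' ∈ S, (∃! c : unitInterval → M, G.IsShortestGeodesic c y y') ∧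
    ∀ c, G.IsShortestGeodesic c y y' → ∀ t, c t ∈ S

/-- `N` is `a`-separated for the leafwise distance. -/
def Separated (G : LeafMetric A) (a : ℝ≥0∞) (N : Set M) : Prop :=
  ∀ y ∈ N, ∀ z ∈ N, y ≠ z → a ≤ G.dF y z

/-- `N` is `r`-dense in the leaf `L` for the leafwise distance. -/
def DenseIn (G : LeafMetric A) (r : ℝ) (N L : Set M) : Prop :=
  ∀ x ∈ L, ∃ z ∈ N, G.dF x z ≤ ENNReal.ofReal r

/-- The net `N_w^W = L_w ∩ τ(W)`. -/
def net (_G : LeafMetric A) (w : X) (W : Set X) : Set M := A.leaf (A.tau w) ∩ A.tau '' W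

end LeafMetric

section Metric

variable {n ν : ℕ} {M X : Type*} [MetricSpace M] [MetricSpace X] {A : Atlas n ν M X}

/-- The separation function `λ_1(δ)` near `w₀`: the greatest lower bound, over all the open sets
`W ∋ w₀` of diameter at most `δ` and all `w ∈ W`, of the separation of the nets `N_w^W`. -/
noncomputable def LeafMetric.lambdaAt (G : LeafMetric A) (w₀ : X) (δ : ℝ) : ℝ≥0∞ :=
  ⨅ (W : Set X) (_ : IsOpen W) (_ : w₀ ∈ W) (_ : Metric.diam W ≤ δ) (w : X) (_ : w ∈ W),
    sSup {a : ℝ≥0∞ | G.Separated a (G.net w W)}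

/-- The separation function `λ_1(δ)` on the whole transversal. -/
noncomputable def LeafMetric.lambdaAll (G : LeafMetric A) (δ : ℝ) : ℝ≥0∞ :=
  ⨅ w₀ : X, G.lambdaAt w₀ δ

/-- The atlas is a regular foliated covering, with the constants `εM`, `lamF` (`λ_F`) and
`delFU` (`δ^F_U`), and the distance of `X` is the one of `M` restricted to the transversal. -/
structure IsRegular (G : LeafMetric A) (εM lamF delFU : ℝ) : Prop where
  lamF_pos : 0 < lamF
  delFU_pos : 0 < delFU
  delFU_lt : delFU < lamF / 5
  locality : ∀ i, ∃ w ∈ A.T i, A.Ubar i ⊆ Metric.ball (A.tau w) εM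
  convex_ball : ∀ x, G.StronglyConvex (G.DF x lamF)
  convex_plaque : ∀ w i, w ∈ A.T i → G.StronglyConvex (A.plaque i w)
  uniformity : ∀ w i, w ∈ A.T i →
    G.DF (A.tau w) (delFU / 2) ⊆ A.plaque i w ∧ A.plaque i w ⊆ G.DF (A.tau w) delFU
  clopen : ∀ i j, IsClopen (A.Tij i j)
  /-- A plaque of `U_i` meets at most one plaque of `U_j`, that is, the transverse change of
  coordinates `h_{j,i}` is well defined on `𝔗_{i,j}`. -/
  meets_unique : ∀ i j w w' w'', A.Meets i j w w' → A.Meets i j w w'' → w' = w''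
  isometry_tau : Isometry A.tau

/-- `I` is a sequence of length `k ≤ N` whose plaque chain starting at `w ∈ V` covers a leafwise
path of length at most `R` from `τ(w)` to a point of `τ(V)`. -/
def IsCodingChain (G : LeafMetric A) (V : Set X) (R : ℝ) (N : ℕ) {k : ℕ}
    (I : Fin (k + 1) → Fin ν) (w : X) : Prop :=
  k ≤ N ∧ w ∈ V ∧ w ∈ A.holDom I ∧ A.hol I w ∈ V ∧
    ∃ γ : ℝ → M, A.IsCurve γ 0 1 (A.tau w) (A.tau (A.hol I w)) ∧
      G.length γ 0 1 ≤ ENNReal.ofReal R ∧ A.Covers I w γ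

open Classical in
/-- The coding function: the code of `u` along `I` is the index `m` such that `h_I(u) ∈ W(m)`
(and `none` if there is no such index). -/
noncomputable def code (A : Atlas n ν M X) {κ : ℕ} (W : Fin κ → Set X) {k : ℕ}
    (I : Fin (k + 1) → Fin ν) (u : X) : Option (Fin κ) :=
  if h : ∃ m, u ∈ A.holDom I ∧ A.hol I u ∈ W m then some h.choose else none

/-- The points `u` and `v` of `W i` have the same code along all paths of length at most `R` that
start in `τ(W i)` and end in `τ(V)`. -/
def SameCode (G : LeafMetric A) (V : Set X) {κ : ℕ} (W : Fin κ → Set X) (i : Fin κ) (R : ℝ) (N : ℕ)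
    (u v : X) : Prop :=
  ∀ w ∈ W i, ∀ (k : ℕ) (I : Fin (k + 1) → Fin ν), IsCodingChain G V R N I w →
    code A W I u = code A W I v

/-- A partition of `V` into `κ` nonempty clopen sets. -/
def IsClopenPartition (V : Set X) {κ : ℕ} (P : Fin κ → Set X) : Prop :=
  (∀ i, IsClopen (P i)) ∧ (∀ i, (P i).Nonempty) ∧ Pairwise (fun i j => Disjoint (P i) (P j)) ∧
    ⋃ i, P i = V

/-- `δ > 0` is a domain radius for the chains of length at most `N` and the image radius `e`. -/
def IsDomainRadius (A : Atlas n ν M X) (e : ℝ) (N : ℕ) (δ : ℝ) : Prop :=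
  0 < δ ∧ δ ≤ e ∧ ∀ k ≤ N, ∀ (I : Fin (k + 1) → Fin ν), ∀ w ∈ A.holDom I,
    Metric.closedBall w δ ⊆ A.holDom I ∧
      MapsTo (A.hol I) (Metric.closedBall w δ) (Metric.closedBall (A.hol I w) e)

end Metric

end Matchbox

/-!
Everything takes place on the transversal `X` and rests on the holonomy maps of plaque chains. For a
regular covering a plaque of one chart meets at most one plaque of another, and the domains of the
transverse changes of coordinates are clopen; hence every holonomy map `h_I` is continuous on a
clopen domain (`IsRegular.isClopen_holDom`, `IsRegular.continuousOn_hol`). There are only finitely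
many `I` of bounded length, so compactness of `X` gives a common domain radius
(`IsRegular.exists_domainRadius`).

The link with the leaf geometry is that a leafwise curve is covered by a plaque chain whose length
is bounded in terms of the length of the curve. The curve is cut at the times when its length
function, which is continuous, reaches multiples of `ε^F_U`; each arc stays in a leafwise ball of
radius `ε^F_U`, so in one chart, and there its transverse coordinate is constant because `X` is
totally disconnected (`exists_chainOn`, `IsRegular.exists_covers`). Consequences:

* Two points of `τ(X)` at leafwise distance less than `r` correspond under one of finitely many
  holonomy maps. Near a point without holonomy such a map is the identity or moves the point away,
  so distinct nearby points of the transversal are at leafwise distance at least `r`. This makes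
  the separation function large at small scales (`IsRegular.exists_lt_lambda`); a Lebesgue number
  makes the scale uniform when no leaf has holonomy.
* Minimality gives chains from any plaque into a given open set of plaques, and compactness bounds
  their length (`IsRegular.exists_coveredByTranslates`). Consecutive centres of a chain are at
  leafwise distance at most `2 δ^F_U`, which makes the nets dense (`IsRegular.denseIn_net`).

For the coding, `V_ℓ` is cut into clopen sets that are small enough for the requirements on both of
the first two partitions. The codes along all the chains of bounded length form a locally constant
function with finitely many values on `X`, and the remaining partitions consist of its fibres
(`IsRegular.exists_isClopenPartition_sameCode`). The set `V_{ℓ+1}` is then any clopen neighbourhood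
of the base point, of small diameter, inside the code class of the base point.
-/

namespace Matchbox
namespace Atlas

section Topological

variable {n ν : ℕ} {M X : Type*} [TopologicalSpace M] [TopologicalSpace X] (A : Atlas n ν M X)

/-! ### Charts and plaques -/

theorem isOpen_openCube (n : ℕ) (r : ℝ) : IsOpen (openCube n r) :=
  isOpen_set_pi finite_univ fun _ _ => isOpen_Ioo

theorem openCube_subset_closedCube (n : ℕ) : openCube n 1 ⊆ closedCube n :=
  pi_mono fun _ _ => Ioo_subset_Icc_self

theorem closedCube_subset_openCube (n : ℕ) : closedCube n ⊆ openCube n 2 :=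
  pi_mono fun _ _ => Icc_subset_Ioo (by norm_num) (by norm_num)

theorem zero_mem_openCube (n : ℕ) {r : ℝ} (hr : 0 < r) : (0 : Fin n → ℝ) ∈ openCube n r :=
  fun _ _ => ⟨by simpa using hr, by simpa using hr⟩

theorem isOpen_U (i : Fin ν) : IsOpen (A.U i) :=
  (A.chart i).isOpen_inter_preimage ((isOpen_openCube n 1).preimage continuous_fst)

theorem isClopen_T (i : Fin ν) : IsClopen (A.T i) :=
  (isClopen_discrete {i}).preimage A.continuous_idx

theorem exists_mem_U (z : M) : ∃ i, z ∈ A.U i := A.covers z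

theorem chart_snd_mem_T {i : Fin ν} {z : M} (hz : z ∈ (A.chart i).source) :
    (A.chart i z).2 ∈ A.T i := by
  have := (A.chart i).map_source hz
  rw [A.target_chart] at this
  exact this.2

theorem mem_plaque_of_mem_U {i : Fin ν} {z : M} (hz : z ∈ A.U i) :
    z ∈ A.plaque i (A.chart i z).2 :=
  ⟨⟨hz.1, openCube_subset_closedCube n hz.2⟩, rfl⟩

theorem mem_target {i : Fin ν} {y : Fin n → ℝ} {w : X} (hy : y ∈ openCube n 2) (hw : w ∈ A.T i) :
    (y, w) ∈ (A.chart i).target := by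
  rw [A.target_chart]; exact ⟨hy, hw⟩

theorem symm_mem_U {i : Fin ν} {y : Fin n → ℝ} {w : X} (hy : y ∈ openCube n 1) (hw : w ∈ A.T i) :
    (A.chart i).symm (y, w) ∈ A.U i := by
  have ht := A.mem_target (closedCube_subset_openCube n (openCube_subset_closedCube n hy)) hw
  exact ⟨(A.chart i).map_target ht, by rw [(A.chart i).right_inv ht]; exact hy⟩

theorem tau_mem_U (w : X) : A.tau w ∈ A.U (A.idx w) :=
  A.symm_mem_U (zero_mem_openCube n one_pos) rfl

theorem chart_tau (w : X) : A.chart (A.idx w) (A.tau w) = (0, w) :=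
  (A.chart _).right_inv (A.mem_target (zero_mem_openCube n two_pos) rfl)

theorem tau_mem_plaque (w : X) : A.tau w ∈ A.plaque (A.idx w) w := by
  have h := A.mem_plaque_of_mem_U (A.tau_mem_U w)
  rwa [A.chart_tau] at h

theorem isPathConnected_plaque {i : Fin ν} {w : X} (hw : w ∈ A.T i) :
    IsPathConnected (A.plaque i w) := by
  have himg : A.plaque i w = (A.chart i).symm '' (closedCube n ×ˢ {w}) := by
    ext z
    constructor
    · rintro ⟨⟨hz, hz1⟩, hz2⟩
      exact ⟨A.chart i z, ⟨hz1, hz2⟩, (A.chart i).left_inv hz⟩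
    · rintro ⟨⟨y, v⟩, ⟨hy, hv⟩, rfl⟩
      obtain rfl : v = w := hv
      have ht := A.mem_target (closedCube_subset_openCube n hy) hw
      refine ⟨⟨(A.chart i).map_target ht, ?_⟩, ?_⟩ <;> rw [(A.chart i).right_inv ht]
      exact hy
  rw [himg]
  have hcube : IsPathConnected (closedCube n) :=
    (convex_pi fun _ _ => convex_Icc _ _).isPathConnected
      ⟨0, openCube_subset_closedCube n (zero_mem_openCube n one_pos)⟩
  refine (hcube.prod (isPathConnected_singleton w)).image' ((A.chart i).continuousOn_symm.mono ?_)
  rintro ⟨y, v⟩ ⟨hy, hv⟩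
  obtain rfl : v = w := hv
  exact A.mem_target (closedCube_subset_openCube n hy) hw

theorem joined_tau_of_mem_plaque {i : Fin ν} {w : X} (hw : w ∈ A.T i) {z : M}
    (hz : z ∈ A.plaque i w) : Joined (A.tau w) z := by
  obtain rfl : A.idx w = i := hw
  exact ((A.isPathConnected_plaque rfl).joinedIn _ (A.tau_mem_plaque w) _ hz).joined

/-- Along a connected set of parameters that stays in one chart, the transverse coordinate is
constant, because the transversal is totally disconnected. -/
theorem chart_snd_eq [TotallyDisconnectedSpace X] {γ : ℝ → M} {S : Set ℝ} (hS : IsPreconnected S)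
    (hγ : ContinuousOn γ S) {i : Fin ν} (hU : MapsTo γ S (A.U i)) {s t : ℝ} (hs : s ∈ S)
    (ht : t ∈ S) : (A.chart i (γ s)).2 = (A.chart i (γ t)).2 := by
  have hc : ContinuousOn (fun r => (A.chart i (γ r)).2) S :=
    continuous_snd.comp_continuousOn ((A.chart i).continuousOn.comp hγ fun r hr => (hU hr).1)
  exact (hS.image _ hc).subsingleton (mem_image_of_mem _ hs) (mem_image_of_mem _ ht)

/-! ### Plaque chains and holonomy maps -/

variable {A}

theorem Meets.left_mem {i j : Fin ν} {w w' : X} (h : A.Meets i j w w') : w ∈ A.T i := by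
  obtain ⟨z, hz, rfl, -⟩ := h
  exact A.chart_snd_mem_T hz.1.1

theorem Meets.right_mem {i j : Fin ν} {w w' : X} (h : A.Meets i j w w') : w' ∈ A.T j := by
  obtain ⟨z, hz, -, rfl⟩ := h
  exact A.chart_snd_mem_T hz.2.1

theorem Meets.symm {i j : Fin ν} {w w' : X} (h : A.Meets i j w w') : A.Meets j i w' w := by
  obtain ⟨z, hz, h1, h2⟩ := h
  exact ⟨z, hz.symm, h2, h1⟩

theorem mem_Tij_iff {i j : Fin ν} {w : X} : w ∈ A.Tij i j ↔ ∃ w', A.Meets i j w w' :=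
  ⟨fun ⟨z, hz, h⟩ => ⟨_, z, hz, h, rfl⟩, fun ⟨_, z, hz, h, _⟩ => ⟨z, hz, h⟩⟩

/-- The transverse change of coordinates extends continuously to nearby plaques: it is the
transverse coordinate in the chart `j` of points that move transversely in the chart `i`. -/
theorem Meets.exists_continuousAt {i j : Fin ν} {w w' : X} (h : A.Meets i j w w') :
    ∃ φ : X → X, ContinuousAt φ w ∧ φ w = w' ∧ ∀ᶠ v in 𝓝 w, A.Meets i j v (φ v) := by
  have hwT := h.left_mem
  obtain ⟨z, ⟨hzi, hzj⟩, rfl, rfl⟩ := h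
  set y := (A.chart i z).1 with hy
  set w := (A.chart i z).2 with hw
  have hyw : (A.chart i).symm (y, w) = z := (A.chart i).left_inv hzi.1
  have hsymm : ContinuousAt (fun v => (A.chart i).symm (y, v)) w := by
    have h1 : ContinuousAt (A.chart i).symm (y, w) :=
      (A.chart i).continuousAt_symm ((A.chart i).map_source hzi.1)
    exact ContinuousAt.comp (f := fun v => (y, v)) h1 (by fun_prop)
  refine ⟨fun v => (A.chart j ((A.chart i).symm (y, v))).2, ?_, by simp only [hyw], ?_⟩
  · have h2 : ContinuousAt (A.chart j) ((A.chart i).symm (y, w)) := by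
      rw [hyw]; exact (A.chart j).continuousAt hzj.1
    exact continuousAt_snd.comp (ContinuousAt.comp h2 hsymm)
  · have hj : ∀ᶠ v in 𝓝 w, (A.chart i).symm (y, v) ∈ A.U j := by
      refine hsymm.eventually_mem ?_
      simp only [hyw]
      exact (A.isOpen_U j).mem_nhds hzj
    filter_upwards [hj, (A.isClopen_T i).isOpen.mem_nhds hwT] with v hv hvT
    refine ⟨_, ⟨A.symm_mem_U hzi.2 hvT, hv⟩, ?_, rfl⟩
    rw [(A.chart i).right_inv
      (A.mem_target (closedCube_subset_openCube n (openCube_subset_closedCube n hzi.2)) hvT)]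

variable (A) in
/-- The plaque chains along `I` lead from `u` to `v`: the graph of the holonomy map `h_I`, described
without choices. -/
def HolTo {k : ℕ} (I : Fin (k + 1) → Fin ν) (u v : X) : Prop :=
  ∃ w, A.IsPlaqueChain I w ∧ w 0 = u ∧ w (Fin.last k) = v

theorem holTo_zero {I : Fin 1 → Fin ν} {u v : X} : A.HolTo I u v ↔ u ∈ A.T (I 0) ∧ u = v := by
  constructor
  · rintro ⟨w, hw, rfl, rfl⟩
    exact ⟨hw.1, rfl⟩
  · rintro ⟨h, rfl⟩
    exact ⟨fun _ => u, ⟨h, fun l => l.elim0⟩, rfl, rfl⟩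

theorem holTo_succ {k : ℕ} {I : Fin (k + 2) → Fin ν} {u v : X} :
    A.HolTo I u v ↔ ∃ v', A.HolTo (fun l : Fin (k + 1) => I l.castSucc) u v' ∧
      A.Meets (I (Fin.last k).castSucc) (I (Fin.last (k + 1))) v' v := by
  constructor
  · rintro ⟨w, hw, rfl, rfl⟩
    exact ⟨w (Fin.last k).castSucc,
      ⟨fun l => w l.castSucc, ⟨hw.1, fun l => hw.2 l.castSucc⟩, rfl, rfl⟩, hw.2 (Fin.last k)⟩
  · rintro ⟨v', ⟨w, hw, rfl, rfl⟩, hm⟩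
    refine ⟨Fin.snoc w v, ⟨?_, fun l => ?_⟩, ?_, by simp⟩
    · rw [← Fin.castSucc_zero, Fin.snoc_castSucc]; exact hw.1
    · refine Fin.lastCases ?_ (fun l => ?_) l
      · simpa only [Fin.snoc_castSucc, Fin.succ_last, Fin.snoc_last] using hm
      · rw [← Fin.castSucc_succ, Fin.snoc_castSucc, Fin.snoc_castSucc]
        exact hw.2 l
    · rw [← Fin.castSucc_zero, Fin.snoc_castSucc]

theorem HolTo.snoc {k : ℕ} {I : Fin (k + 1) → Fin ν} {u v v' : X} {j : Fin ν} (h : A.HolTo I u v')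
    (hm : A.Meets (I (Fin.last k)) j v' v) :
    A.HolTo (Fin.snoc I j : Fin (k + 2) → Fin ν) u v :=
  holTo_succ.2 ⟨v', by simpa only [Fin.snoc_castSucc] using h,
    by simpa only [Fin.snoc_castSucc, Fin.snoc_last] using hm⟩

theorem HolTo.right_mem {k : ℕ} {I : Fin (k + 1) → Fin ν} {u v : X} (h : A.HolTo I u v) :
    v ∈ A.T (I (Fin.last k)) := by
  cases k with
  | zero => obtain ⟨h', rfl⟩ := holTo_zero.1 h; exact h'
  | succ k => obtain ⟨v', -, h⟩ := holTo_succ.1 h; exact h.right_mem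

theorem HolTo.symm {k : ℕ} {I : Fin (k + 1) → Fin ν} {u v : X} (h : A.HolTo I u v) :
    A.HolTo (fun l => I l.rev) v u := by
  have hv := h.right_mem
  obtain ⟨w, hw, rfl, rfl⟩ := h
  refine ⟨fun l => w l.rev, ⟨?_, fun l => ?_⟩, ?_, ?_⟩
  · simpa only [Fin.rev_zero] using hv
  · simpa only [Fin.rev_castSucc, Fin.rev_succ] using (hw.2 l.rev).symm
  · simp only [Fin.rev_zero]
  · simp only [Fin.rev_last]

theorem HolTo.exists_continuousAt {k : ℕ} {I : Fin (k + 1) → Fin ν} {u v : X}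
    (h : A.HolTo I u v) :
    ∃ φ : X → X, ContinuousAt φ u ∧ φ u = v ∧ ∀ᶠ u' in 𝓝 u, A.HolTo I u' (φ u') := by
  induction k generalizing v with
  | zero =>
    obtain ⟨h', rfl⟩ := holTo_zero.1 h
    refine ⟨id, continuousAt_id, rfl, ?_⟩
    filter_upwards [(A.isClopen_T _).isOpen.mem_nhds h'] with u' hu'
    exact holTo_zero.2 ⟨hu', rfl⟩
  | succ k ih =>
    obtain ⟨v', h, hm⟩ := holTo_succ.1 h
    obtain ⟨φ, hφ, rfl, hφ'⟩ := ih h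
    obtain ⟨ψ, hψ, rfl, hψ'⟩ := hm.exists_continuousAt
    refine ⟨ψ ∘ φ, hψ.comp hφ, rfl, ?_⟩
    filter_upwards [hφ', hφ.eventually hψ'] with u' h1 h2
    exact holTo_succ.2 ⟨_, h1, h2⟩

theorem mem_holDom_iff {k : ℕ} {I : Fin (k + 1) → Fin ν} {u : X} :
    u ∈ A.holDom I ↔ ∃ v, A.HolTo I u v :=
  ⟨fun ⟨w, hw, h⟩ => ⟨_, w, hw, h, rfl⟩, fun ⟨_, w, hw, h, _⟩ => ⟨w, hw, h⟩⟩

theorem HolTo.mem_holDom {k : ℕ} {I : Fin (k + 1) → Fin ν} {u v : X} (h : A.HolTo I u v) :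
    u ∈ A.holDom I := mem_holDom_iff.2 ⟨v, h⟩

theorem holTo_hol {k : ℕ} {I : Fin (k + 1) → Fin ν} {u : X} (h : u ∈ A.holDom I) :
    A.HolTo I u (A.hol I u) := by
  rw [hol, dif_pos h]
  exact ⟨_, h.choose_spec.1, h.choose_spec.2, rfl⟩

theorem joined_of_holTo {k : ℕ} {I : Fin (k + 1) → Fin ν} {u v : X} (h : A.HolTo I u v) :
    Joined (A.tau u) (A.tau v) := by
  induction k generalizing v with
  | zero => obtain ⟨-, rfl⟩ := holTo_zero.1 h; exact Joined.refl _
  | succ k ih =>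
    obtain ⟨v', h', hm⟩ := holTo_succ.1 h
    have h1 := hm.left_mem
    have h2 := hm.right_mem
    obtain ⟨z, ⟨hzi, hzj⟩, rfl, rfl⟩ := hm
    exact (ih h').trans ((A.joined_tau_of_mem_plaque h1 (A.mem_plaque_of_mem_U hzi)).trans
      (A.joined_tau_of_mem_plaque h2 (A.mem_plaque_of_mem_U hzj)).symm)

end Topological
end Atlas

open Atlas

/-! ### Holonomy maps of a regular covering -/

section Regular

variable {n ν : ℕ} {M X : Type*} [MetricSpace M] [MetricSpace X] {A : Atlas n ν M X}
  {G : LeafMetric A} {εM lamF delFU : ℝ}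

theorem IsRegular.holTo_unique (hreg : IsRegular G εM lamF delFU) {k : ℕ}
    {I : Fin (k + 1) → Fin ν} {u v v' : X} (h : A.HolTo I u v) (h' : A.HolTo I u v') : v = v' := by
  induction k generalizing v v' with
  | zero => exact (holTo_zero.1 h).2.symm.trans (holTo_zero.1 h').2
  | succ k ih =>
    obtain ⟨x, hx, hxv⟩ := holTo_succ.1 h
    obtain ⟨x', hx', hxv'⟩ := holTo_succ.1 h'
    obtain rfl := ih hx hx'
    exact hreg.meets_unique _ _ _ _ _ hxv hxv'

theorem IsRegular.hol_eq (hreg : IsRegular G εM lamF delFU) {k : ℕ} {I : Fin (k + 1) → Fin ν}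
    {u v : X} (h : A.HolTo I u v) : A.hol I u = v :=
  hreg.holTo_unique (holTo_hol h.mem_holDom) h

theorem isOpen_holDom {k : ℕ} (I : Fin (k + 1) → Fin ν) : IsOpen (A.holDom I) := by
  refine isOpen_iff_mem_nhds.2 fun u hu => ?_
  obtain ⟨φ, -, -, h⟩ := (holTo_hol hu).exists_continuousAt
  exact h.mono fun _ h => h.mem_holDom

theorem IsRegular.continuousAt_hol (hreg : IsRegular G εM lamF delFU) {k : ℕ}
    {I : Fin (k + 1) → Fin ν} {u : X} (hu : u ∈ A.holDom I) : ContinuousAt (A.hol I) u := by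
  obtain ⟨φ, hφ, -, h⟩ := (holTo_hol hu).exists_continuousAt
  exact hφ.congr (h.mono fun _ h => (hreg.hol_eq h).symm)

theorem IsRegular.continuousOn_hol (hreg : IsRegular G εM lamF delFU) {k : ℕ}
    (I : Fin (k + 1) → Fin ν) : ContinuousOn (A.hol I) (A.holDom I) :=
  fun _ hu => (hreg.continuousAt_hol hu).continuousWithinAt

theorem IsRegular.isClopen_holDom (hreg : IsRegular G εM lamF delFU) {k : ℕ}
    (I : Fin (k + 1) → Fin ν) : IsClopen (A.holDom I) := by
  refine ⟨?_, isOpen_holDom I⟩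
  induction k with
  | zero =>
    convert (A.isClopen_T (I 0)).isClosed using 1
    ext u
    simp [mem_holDom_iff, holTo_zero]
  | succ k ih =>
    set J : Fin (k + 1) → Fin ν := fun l => I l.castSucc with hJ
    convert (hreg.continuousOn_hol J).preimage_isClosed_of_isClosed (ih J)
      (hreg.clopen (I (Fin.last k).castSucc) (I (Fin.last (k + 1)))).isClosed using 1
    ext u
    rw [mem_holDom_iff, mem_inter_iff, mem_preimage, mem_Tij_iff]
    constructor
    · rintro ⟨v, hv⟩
      obtain ⟨v', h, hm⟩ := holTo_succ.1 hv
      exact ⟨h.mem_holDom, v, by rwa [hreg.hol_eq h]⟩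
    · rintro ⟨hu, v, hm⟩
      exact ⟨v, holTo_succ.2 ⟨_, holTo_hol hu, hm⟩⟩

/-- The preimage of a clopen set under a holonomy map is clopen. -/
theorem IsRegular.isClopen_preimage_hol (hreg : IsRegular G εM lamF delFU) {k : ℕ}
    (I : Fin (k + 1) → Fin ν) {S : Set X} (hS : IsClopen S) :
    IsClopen (A.holDom I ∩ A.hol I ⁻¹' S) :=
  ⟨(hreg.continuousOn_hol I).preimage_isClosed_of_isClosed (hreg.isClopen_holDom I).isClosed
    hS.isClosed, (hreg.continuousOn_hol I).isOpen_inter_preimage (isOpen_holDom I) hS.isOpen⟩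

/-- Only finitely many holonomy maps have a given bound on the word length, so a property of small
`δ` that each of them has on its own holds for all of them at once. -/
theorem exists_forall_chain {ν : ℕ} (N : ℕ) {p : ∀ k, (Fin (k + 1) → Fin ν) → ℝ → Prop}
    (hmono : ∀ k I δ δ', δ ≤ δ' → p k I δ' → p k I δ)
    (h : ∀ k I, ∃ δ > 0, p k I δ) : ∃ δ > 0, ∀ k ≤ N, ∀ I, p k I δ := by
  choose d hd hp using h
  obtain ⟨δ, hδ, h⟩ : ∃ δ > 0, ∀ x : Σ k : Fin (N + 1), (Fin (k + 1) → Fin ν), δ ≤ d x.1 x.2 := by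
    cases isEmpty_or_nonempty (Σ k : Fin (N + 1), (Fin ((k : ℕ) + 1) → Fin ν)) with
    | inl _ => exact ⟨1, one_pos, fun x => isEmptyElim x⟩
    | inr _ =>
      obtain ⟨x, hx⟩ := Finite.exists_min fun x : Σ k : Fin (N + 1), (Fin ((k : ℕ) + 1) → Fin ν) =>
        d x.1 x.2
      exact ⟨_, hd _ _, hx⟩
  exact ⟨δ, hδ, fun k hk I =>
    hmono _ _ _ _ (h ⟨⟨k, Nat.lt_succ_of_le hk⟩, I⟩) (hp k I)⟩

theorem IsRegular.exists_domainRadius [CompactSpace X] (hreg : IsRegular G εM lamF delFU) {e : ℝ}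
    (he : 0 < e) (N : ℕ) : ∃ δ, IsDomainRadius A e N δ := by
  obtain ⟨δ, hδ, h⟩ := exists_forall_chain (ν := ν) N
    (p := fun k I δ => ∀ w ∈ A.holDom I, Metric.closedBall w δ ⊆ A.holDom I ∧
      MapsTo (A.hol I) (Metric.closedBall w δ) (Metric.closedBall (A.hol I w) e))
    (fun k I δ δ' hδ h w hw => ⟨(Metric.closedBall_subset_closedBall hδ).trans (h w hw).1,
      (h w hw).2.mono_left (Metric.closedBall_subset_closedBall hδ)⟩)
    (fun k I => by
      have hc : IsCompact (A.holDom I) := (hreg.isClopen_holDom I).isClosed.isCompact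
      obtain ⟨δ₁, hδ₁, h₁⟩ := hc.exists_cthickening_subset_open (isOpen_holDom I) subset_rfl
      obtain ⟨δ₂, hδ₂, h₂⟩ := Metric.uniformContinuousOn_iff_le.1
        (hc.uniformContinuousOn_of_continuous (hreg.continuousOn_hol I)) e he
      refine ⟨min δ₁ δ₂, lt_min hδ₁ hδ₂, fun w hw => ?_⟩
      have hsub : Metric.closedBall w (min δ₁ δ₂) ⊆ A.holDom I := fun x hx =>
        h₁ (Metric.closedBall_subset_cthickening hw _
          (Metric.closedBall_subset_closedBall (min_le_left _ _) hx))
      exact ⟨hsub, fun x hx => h₂ x (hsub hx) w hw (hx.trans (min_le_right _ _))⟩)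
  exact ⟨min δ e, lt_min hδ he, min_le_right _ _, fun k hk I w hw =>
    ⟨(Metric.closedBall_subset_closedBall (min_le_left _ _)).trans (h k hk I w hw).1,
      (h k hk I w hw).2.mono_left (Metric.closedBall_subset_closedBall (min_le_left _ _))⟩⟩

/-- Near a point without holonomy, the holonomy maps of bounded word length are the identity or move
points far away. -/
theorem IsRegular.exists_ball_hol_trivial (hreg : IsRegular G εM lamF delFU) {x : X}
    (hx : A.WithoutHolonomy x) (N : ℕ) : ∃ δ > 0, ∀ k ≤ N, ∀ I : Fin (k + 1) → Fin ν,
      ∀ u ∈ Metric.ball x δ, ∀ v ∈ Metric.ball x δ, A.HolTo I u v → u = v := by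
  refine exists_forall_chain N
    (fun k I δ δ' hδ h u hu v hv => h u (Metric.ball_subset_ball hδ hu) v
      (Metric.ball_subset_ball hδ hv)) fun k I => ?_
  by_cases hxI : x ∈ A.holDom I
  · by_cases hfix : A.hol I x = x
    · obtain ⟨δ, hδ, h⟩ := Metric.eventually_nhds_iff_ball.1 (hx k I hxI hfix)
      exact ⟨δ, hδ, fun u hu v _ huv => (h u hu).symm.trans (hreg.hol_eq huv)⟩
    · obtain ⟨O, O', hO, hO', hxO, hxO', hdisj⟩ := t2_separation hfix
      obtain ⟨δ, hδ, h⟩ := Metric.eventually_nhds_iff_ball.1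
        (((hreg.continuousAt_hol hxI).eventually_mem (hO.mem_nhds hxO)).and (hO'.mem_nhds hxO'))
      refine ⟨δ, hδ, fun u hu v hv huv => ?_⟩
      rw [← hreg.hol_eq huv] at hv ⊢
      exact (hdisj.ne_of_mem (h u hu).1 (h _ hv).2 rfl).elim
  · obtain ⟨δ, hδ, h⟩ := Metric.isOpen_iff.1 (hreg.isClopen_holDom I).compl.isOpen x hxI
    exact ⟨δ, hδ, fun u hu v _ huv => (h hu huv.mem_holDom).elim⟩

/-! ### Translates of a transverse open set -/

/-- The plaque of `x` is linked with the points of its leaf by plaque chains. -/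
theorem exists_holTo_of_joined [TotallyDisconnectedSpace X] {x : X} {z : M} {j : Fin ν}
    (h : Joined (A.tau x) z) (hz : z ∈ A.U j) :
    ∃ k, ∃ I : Fin (k + 1) → Fin ν, A.HolTo I x (A.chart j z).2 := by
  obtain ⟨γ⟩ := h
  set Reach : M → Prop := fun z => ∃ k, ∃ I : Fin (k + 1) → Fin ν,
    z ∈ A.U (I (Fin.last k)) ∧ A.HolTo I x (A.chart (I (Fin.last k)) z).2
  have hmove : ∀ {i z z'}, z ∈ A.U i → z' ∈ A.U i → (A.chart i z).2 = (A.chart i z').2 →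
      Reach z → Reach z' := by
    rintro i z z' hz hz' heq ⟨k, I, hzI, hI⟩
    refine ⟨k + 1, Fin.snoc I i, by simpa using hz', ?_⟩
    simp only [Fin.snoc_last]
    exact hI.snoc ⟨z, ⟨hzI, hz⟩, rfl, heq⟩
  have hloc : IsLocallyConstant fun t => Reach (γ.extend t) := by
    refine (IsLocallyConstant.iff_eventually_eq _).2 fun t => ?_
    obtain ⟨i, hi⟩ := A.exists_mem_U (γ.extend t)
    obtain ⟨r, hr, hball⟩ := Metric.mem_nhds_iff.1
      (γ.continuous_extend.continuousAt.preimage_mem_nhds ((A.isOpen_U i).mem_nhds hi))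
    filter_upwards [Metric.ball_mem_nhds t hr] with s hs
    have heq := A.chart_snd_eq (convex_ball t r).isPreconnected γ.continuous_extend.continuousOn
      hball hs (Metric.mem_ball_self hr)
    exact propext ⟨hmove (hball hs) hi heq, hmove hi (hball hs) heq.symm⟩
  have h0 : Reach (γ.extend 0) := by
    refine ⟨0, fun _ => A.idx x, ?_, ?_⟩ <;> rw [γ.extend_zero]
    · exact A.tau_mem_U x
    · rw [A.chart_tau]; exact holTo_zero.2 ⟨rfl, rfl⟩
  have h1 : Reach (γ.extend 1) := (hloc.apply_eq_of_preconnectedSpace 0 1).mp h0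
  rw [γ.extend_one] at h1
  obtain ⟨k, I, hzI, hI⟩ := h1
  exact ⟨k + 1, Fin.snoc I j, hI.snoc ⟨z, ⟨hzI, hz⟩, rfl, rfl⟩⟩

theorem IsRegular.exists_coveredByTranslates [CompactSpace X] [TotallyDisconnectedSpace X]
    (hreg : IsRegular G εM lamF delFU)
    (hmin : ∀ x : M, Dense (A.leaf x)) {V : Set X} (hV : IsOpen V) {w₀ : X} (hw₀ : w₀ ∈ V) :
    ∃ α, A.CoveredByTranslates V α := by
  set O : Set M := A.U (A.idx w₀) ∩ (fun z => (A.chart (A.idx w₀) z).2) ⁻¹' V with hO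
  have hOo : IsOpen O :=
    (continuous_snd.comp_continuousOn ((A.chart _).continuousOn.mono fun z hz => hz.1)
      ).isOpen_inter_preimage (A.isOpen_U _) hV
  have hOne : O.Nonempty := ⟨A.tau w₀, A.tau_mem_U w₀, by simpa [A.chart_tau] using hw₀⟩
  have hloc : ∀ x : X, ∃ k, ∀ᶠ x' in 𝓝 x, ∃ I : Fin (k + 1) → Fin ν, ∃ u ∈ V, A.HolTo I u x' := by
    intro x
    obtain ⟨z, hz, hxz⟩ := (hmin (A.tau x)).inter_open_nonempty O hOo hOne
    obtain ⟨k, I, hI⟩ := exists_holTo_of_joined hxz hz.1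
    obtain ⟨φ, hφ, hφx, h⟩ := hI.exists_continuousAt
    have hmem : ∀ᶠ x' in 𝓝 x, φ x' ∈ V := hφ.eventually_mem (hV.mem_nhds (hφx ▸ hz.2))
    refine ⟨k, ?_⟩
    filter_upwards [h, hmem] with x' h1 h2
    exact ⟨_, _, h2, h1.symm⟩
  choose k hk using hloc
  obtain ⟨t, ht⟩ := CompactSpace.elim_nhds_subcover _ hk
  refine ⟨t.sup k, fun x => ?_⟩
  have hx : x ∈ ⋃ y ∈ t, {x' | ∃ I : Fin (k y + 1) → Fin ν, ∃ u ∈ V, A.HolTo I u x'} := by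
    rw [ht]; trivial
  obtain ⟨y, hy, I, u, hu, h⟩ := mem_iUnion₂.1 hx
  exact ⟨k y, Finset.le_sup hy, I, u, ⟨hu, h.mem_holDom⟩, hreg.hol_eq h⟩

end Regular

/-! ### Leafwise curves and the triangle inequality -/

section Concat

open Classical in
/-- The concatenation at time `b` of two paths. -/
noncomputable def concat {E : Type*} (γ γ' : ℝ → E) (b : ℝ) (s : ℝ) : E :=
  if s ≤ b then γ s else γ' s

theorem concat_of_le {E : Type*} {γ γ' : ℝ → E} {b s : ℝ} (h : s ≤ b) :
    concat γ γ' b s = γ s := if_pos h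

theorem concat_of_ge {E : Type*} {γ γ' : ℝ → E} {b s : ℝ} (hb : γ b = γ' b) (h : b ≤ s) :
    concat γ γ' b s = γ' s := by
  rcases h.eq_or_lt with rfl | h
  · rw [concat_of_le le_rfl, hb]
  · exact if_neg h.not_ge

end Concat

section Curves

variable {n ν : ℕ} {M X : Type*} [TopologicalSpace M] [TopologicalSpace X] {A : Atlas n ν M X}
  {G : LeafMetric A}

/-- `γ` stays in one chart over `S`, and its leaf coordinate there is `C¹`. -/
def Atlas.IsC1On (A : Atlas n ν M X) (γ : ℝ → M) (S : Set ℝ) : Prop :=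
  ∃ i : Fin ν, MapsTo γ S (A.U i) ∧ ContDiffOn ℝ 1 (fun s => (A.chart i (γ s)).1) S

theorem Atlas.IsC1On.mono {γ : ℝ → M} {S S' : Set ℝ} (h : A.IsC1On γ S) (hS : S' ⊆ S) :
    A.IsC1On γ S' := by
  obtain ⟨i, h1, h2⟩ := h
  exact ⟨i, h1.mono_left hS, h2.mono hS⟩

theorem Atlas.IsC1On.congr {γ γ' : ℝ → M} {S : Set ℝ} (h : A.IsC1On γ S) (hS : EqOn γ' γ S) :
    A.IsC1On γ' S := by
  obtain ⟨i, h1, h2⟩ := h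
  exact ⟨i, h1.congr hS.symm, h2.congr fun s hs => by rw [hS hs]⟩

theorem Atlas.isC1On_singleton (γ : ℝ → M) (a : ℝ) : A.IsC1On γ {a} := by
  obtain ⟨i, hi⟩ := A.exists_mem_U (γ a)
  refine ⟨i, by rintro _ rfl; exact hi, ?_⟩
  rintro _ rfl
  exact contDiffWithinAt_singleton

/-- The breakpoints of a piecewise `C¹` curve may be taken from a monotone sequence on `ℕ`, which is
easier to cut and to concatenate. -/
theorem Atlas.isCurve_iff {γ : ℝ → M} {a b : ℝ} {x y : M} : A.IsCurve γ a b x y ↔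
    a ≤ b ∧ ContinuousOn γ (Icc a b) ∧ γ a = x ∧ γ b = y ∧ ∃ (m : ℕ) (t : ℕ → ℝ), Monotone t ∧
      t 0 = a ∧ t m = b ∧ ∀ l < m, A.IsC1On γ (Icc (t l) (t (l + 1))) := by
  refine and_congr_right fun _ => and_congr_right fun _ => and_congr_right fun _ =>
    and_congr_right fun _ => exists_congr fun m => ⟨?_, ?_⟩
  · rintro ⟨t, ht, h0, hm, h⟩
    refine ⟨fun l => t ⟨min l m, by omega⟩, fun l l' hl => ht ?_, ?_, ?_, fun l hl => ?_⟩
    · exact Fin.mk_le_mk.2 (min_le_min_right m hl)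
    · rw [← h0]; congr 1
    · exact (congrArg t (Fin.ext (by simp))).trans hm
    · have := h ⟨l, hl⟩
      have e1 : (⟨min l m, by omega⟩ : Fin (m + 1)) = (⟨l, hl⟩ : Fin m).castSucc := by
        ext; simp; omega
      have e2 : (⟨min (l + 1) m, by omega⟩ : Fin (m + 1)) = (⟨l, hl⟩ : Fin m).succ := by
        ext; simp; omega
      simp only [e1, e2]
      exact this
  · rintro ⟨t, ht, h0, hm, h⟩
    exact ⟨fun l => t l, fun l l' hl => ht hl, h0, hm, fun l => h l l.2⟩

theorem Atlas.isCurve_self (x : M) : A.IsCurve (fun _ => x) 0 0 x x :=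
  isCurve_iff.2 ⟨le_rfl, continuousOn_const, rfl, rfl, 0, fun _ => 0, monotone_const, rfl, rfl,
    fun l hl => by omega⟩

theorem Atlas.IsCurve.restrict {γ : ℝ → M} {a b c d : ℝ} {x y : M} (h : A.IsCurve γ a b x y)
    (hac : a ≤ c) (hcd : c ≤ d) (hdb : d ≤ b) : A.IsCurve γ c d (γ c) (γ d) := by
  obtain ⟨-, hγ, -, -, m, t, ht, h0, hm, h⟩ := isCurve_iff.1 h
  refine isCurve_iff.2 ⟨hcd, hγ.mono (Icc_subset_Icc hac hdb), rfl, rfl, m,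
    fun l => max c (min d (t l)), ?_, ?_, ?_, fun l hl => ?_⟩
  · exact fun l l' hl => max_le_max_left c (min_le_min_left d (ht hl))
  · simp [h0, hac.trans hcd, hac]
  · simp [hm, hdb, hcd]
  · have hle := ht (Nat.le_succ l)
    rcases le_total (t (l + 1)) c with h1 | h1
    · have e1 : max c (min d (t l)) = c := max_eq_left (min_le_of_right_le (hle.trans h1))
      have e2 : max c (min d (t (l + 1))) = c := max_eq_left (min_le_of_right_le h1)
      simp only [e1, e2, Icc_self]
      exact isC1On_singleton _ _
    rcases le_total d (t l) with h2 | h2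
    · have e1 : min d (t l) = d := min_eq_left h2
      have e2 : min d (t (l + 1)) = d := min_eq_left (h2.trans hle)
      simp only [e1, e2, Icc_self]
      exact isC1On_singleton _ _
    · exact (h l hl).mono (Icc_subset_Icc (le_max_of_le_right (le_min h2 le_rfl))
        (max_le h1 (min_le_right _ _)))

theorem Atlas.IsCurve.translate {γ : ℝ → M} {a b : ℝ} {x y : M} (h : A.IsCurve γ a b x y) (c : ℝ) :
    A.IsCurve (fun s => γ (s + c)) (a - c) (b - c) x y := by
  obtain ⟨hab, hγ, hx, hy, m, t, ht, h0, hm, h⟩ := isCurve_iff.1 h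
  have hmaps : ∀ p q : ℝ, MapsTo (fun s => s + c) (Icc (p - c) (q - c)) (Icc p q) :=
    fun p q s hs => ⟨by linarith [hs.1], by linarith [hs.2]⟩
  refine isCurve_iff.2 ⟨by linarith, hγ.comp (by fun_prop) (hmaps a b), by simpa using hx,
    by simpa using hy, m, fun l => t l - c, fun l l' hl => by simpa using ht hl, by simp [h0],
    by simp [hm], fun l hl => ?_⟩
  obtain ⟨i, h1, h2⟩ := h l hl
  exact ⟨i, h1.comp (hmaps _ _), h2.comp (by fun_prop) (hmaps _ _)⟩

theorem Atlas.IsCurve.concat {γ γ' : ℝ → M} {a b c : ℝ} {x y z : M} (h : A.IsCurve γ a b x y)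
    (h' : A.IsCurve γ' b c y z) : A.IsCurve (concat γ γ' b) a c x z := by
  obtain ⟨hab, hγ, hx, hy, m, t, ht, h0, hm, h⟩ := isCurve_iff.1 h
  obtain ⟨hbc, hγ', hx', hy', m', t', ht', h0', hm', h'⟩ := isCurve_iff.1 h'
  have hb : γ b = γ' b := hy.trans hx'.symm
  have e1 : EqOn (Matchbox.concat γ γ' b) γ (Iic b) := fun s hs => concat_of_le hs
  have e2 : EqOn (Matchbox.concat γ γ' b) γ' (Ici b) := fun s hs => concat_of_ge hb hs
  have hle : ∀ l ≤ m, t l ≤ b := fun l hl => (ht hl).trans hm.le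
  have hge : ∀ l, b ≤ t' l := fun l => h0'.symm.le.trans (ht' (Nat.zero_le l))
  refine isCurve_iff.2 ⟨hab.trans hbc, ?_, (e1 hab).trans hx, (e2 hbc).trans hy', m + m',
    fun l => if l ≤ m then t l else t' (l - m), ?_, ?_, ?_, fun l hl => ?_⟩
  · rw [← Icc_union_Icc_eq_Icc hab hbc]
    exact (hγ.congr (e1.mono fun s hs => hs.2)).union_of_isClosed
      (hγ'.congr (e2.mono fun s hs => hs.1)) isClosed_Icc isClosed_Icc
  · intro l l' hl
    by_cases h1 : l' ≤ m
    · simp only [h1, hl.trans h1, if_true]; exact ht hl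
    · by_cases h2 : l ≤ m
      · simp only [h1, h2, if_true, if_false]; exact (hle l h2).trans (hge _)
      · simp only [h1, h2, if_false]; exact ht' (Nat.sub_le_sub_right hl m)
  · simp [h0]
  · by_cases h1 : m' = 0
    · subst h1
      simp [hm, ← hm', h0']
    · have h2 : ¬ m + m' ≤ m := by omega
      simp [h1, hm']
  · by_cases h1 : l + 1 ≤ m
    · simp only [h1, (Nat.le_succ l).trans h1, if_true]
      exact (h l h1).congr (e1.mono fun s hs => hs.2.trans (hle _ h1))
    · have h3 : (if l ≤ m then t l else t' (l - m)) = t' (l - m) := by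
        split_ifs with h2
        · obtain rfl : l = m := by omega
          simp [hm, h0']
        · rfl
      simp only [h1, if_false, h3, show l + 1 - m = l - m + 1 by omega]
      exact (h' (l - m) (by omega)).congr (e2.mono fun s hs => (hge _).trans hs.1)

theorem LeafMetric.speed_congr {γ γ' : ℝ → M} {t : ℝ} (h : γ =ᶠ[𝓝 t] γ') :
    G.speed γ t = G.speed γ' t := by
  have hd : ∀ i, deriv (fun s => (A.chart i (γ s)).1) t = deriv (fun s => (A.chart i (γ' s)).1) t :=
    fun i => Filter.EventuallyEq.deriv_eq (h.mono fun s hs => by simp only [hs])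
  simp only [speed, h.eq_of_nhds, hd]

theorem LeafMetric.length_congr {γ γ' : ℝ → M} {a b : ℝ} (h : EqOn γ γ' (Icc a b)) :
    G.length γ a b = G.length γ' a b := by
  simp only [length, MeasureTheory.restrict_Ioo_eq_restrict_Icc.symm]
  refine MeasureTheory.setLIntegral_congr_fun measurableSet_Ioo fun t ht => speed_congr ?_
  filter_upwards [Ioo_mem_nhds ht.1 ht.2] with s hs using h (Ioo_subset_Icc_self hs)

theorem LeafMetric.length_translate (γ : ℝ → M) (a b c : ℝ) :
    G.length (fun s => γ (s + c)) (a - c) (b - c) = G.length γ a b := by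
  have hs : ∀ t, G.speed (fun s => γ (s + c)) t = G.speed γ (t + c) := by
    intro t
    have hd : ∀ i, deriv (fun s => (A.chart i (γ (s + c))).1) t =
        deriv (fun s => (A.chart i (γ s)).1) (t + c) :=
      fun i => deriv_comp_add_const (fun s => (A.chart i (γ s)).1) c t
    simp only [speed, hd]
  simp only [length, hs]
  rw [← preimage_add_const_Icc, (MeasureTheory.measurePreserving_add_right MeasureTheory.volume c
    ).setLIntegral_comp_preimage_emb (measurableEmbedding_addRight c)
      (G.speed γ) (Icc a b)]

theorem LeafMetric.length_add (γ : ℝ → M) {a b c : ℝ} (hab : a ≤ b) (hbc : b ≤ c) :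
    G.length γ a b + G.length γ b c = G.length γ a c := by
  simp only [length]
  rw [← Icc_union_Ioc_eq_Icc hab hbc, MeasureTheory.lintegral_union measurableSet_Ioc
    (disjoint_left.2 fun s hs hs' => hs'.1.not_ge hs.2), MeasureTheory.restrict_Ioc_eq_restrict_Icc]

theorem LeafMetric.dF_le_length {γ : ℝ → M} {a b : ℝ} {x y : M} (h : A.IsCurve γ a b x y) :
    G.dF x y ≤ G.length γ a b :=
  iInf_le_of_le γ (iInf_le_of_le a (iInf_le_of_le b (iInf_le _ h)))

theorem LeafMetric.exists_curve_of_dF_lt {x y : M} {r : ℝ≥0∞} (h : G.dF x y < r) :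
    ∃ (γ : ℝ → M) (a b : ℝ), A.IsCurve γ a b x y ∧ G.length γ a b < r := by
  simpa only [dF, iInf_lt_iff, exists_prop] using h

theorem LeafMetric.dF_self (x : M) : G.dF x x = 0 :=
  le_antisymm ((dF_le_length (isCurve_self x)).trans (by simp [length])) zero_le

theorem LeafMetric.dF_triangle (x y z : M) : G.dF x z ≤ G.dF x y + G.dF y z := by
  conv_rhs => simp only [dF, ENNReal.iInf_add, ENNReal.add_iInf]
  refine le_iInf fun γ' => le_iInf fun a' => le_iInf fun b' => le_iInf fun hγ' =>
    le_iInf fun γ => le_iInf fun a => le_iInf fun b => le_iInf fun hγ => ?_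
  have hc := hγ'.translate (a' - b)
  rw [sub_sub_cancel] at hc
  have hlen := G.length_translate γ' a' b' (a' - b)
  rw [sub_sub_cancel] at hlen
  have hcat := hγ.concat hc
  have hb : γ b = γ' (b + (a' - b)) := hγ.2.2.2.1.trans hc.2.2.1.symm
  calc G.dF x z ≤ G.length (concat γ (fun s => γ' (s + (a' - b))) b) a (b' - (a' - b)) :=
        dF_le_length hcat
    _ = _ := (G.length_add _ hγ.1 hc.1).symm
    _ = G.length γ a b + G.length γ' a' b' := by
        rw [← hlen, length_congr fun s hs => concat_of_le hs.2,
          length_congr fun s hs => concat_of_ge hb hs.1]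

/-- The length of a curve of finite length depends continuously on its endpoint. -/
theorem LeafMetric.continuousOn_length {γ : ℝ → M} {a b : ℝ} (h : G.length γ a b ≠ ⊤) :
    ContinuousOn (fun t => G.length γ a t) (Icc a b) := by
  have hle : ∀ s ∈ Icc a b, ∀ t ∈ Icc a b, G.length γ a t ≤ G.length γ a s +
      ∫⁻ r in Ioc s t, G.speed γ r ∂(MeasureTheory.volume.restrict (Icc a b)) := by
    intro s hs t ht
    rcases le_total s t with hst | hst
    · rw [← G.length_add γ hs.1 hst, MeasureTheory.Measure.restrict_restrict measurableSet_Ioc,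
        inter_eq_left.2 (Ioc_subset_Icc_self.trans (Icc_subset_Icc hs.1 ht.2)), length,
        length, MeasureTheory.restrict_Ioc_eq_restrict_Icc]
    · exact le_add_right (MeasureTheory.lintegral_mono_set (Icc_subset_Icc_right hst))
  have hsmall : ∀ s : ℝ, ∀ f : ℝ → Set ℝ, (∀ t, MeasureTheory.volume (f t) ≤ edist t s) →
      Filter.Tendsto (fun t => ∫⁻ r in f t, G.speed γ r
        ∂(MeasureTheory.volume.restrict (Icc a b))) (𝓝[Icc a b] s) (𝓝 0) := by
    intro s f hf
    refine MeasureTheory.tendsto_setLIntegral_zero h ?_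
    refine tendsto_of_tendsto_of_tendsto_of_le_of_le tendsto_const_nhds
      (h := fun t => edist t s) ?_ (fun _ => zero_le) fun t =>
        (MeasureTheory.Measure.restrict_apply_le _ _).trans (hf t)
    have : ContinuousAt (fun t => edist t s) s := by fun_prop
    simpa [ContinuousAt] using this.tendsto.mono_left nhdsWithin_le_nhds
  intro s hs
  have hfin : G.length γ a s ≠ ⊤ :=
    ((MeasureTheory.lintegral_mono_set (Icc_subset_Icc_right hs.2)).trans_lt h.lt_top).ne
  refine (ENNReal.tendsto_nhds hfin).2 fun ε hε => ?_
  have h1 := hsmall s (fun t => Ioc s t) fun t => by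
    rw [Real.volume_Ioc, edist_dist, Real.dist_eq]; exact ENNReal.ofReal_le_ofReal (le_abs_self _)
  have h2 := hsmall s (fun t => Ioc t s) fun t => by
    rw [Real.volume_Ioc, edist_comm, edist_dist, Real.dist_eq]
    exact ENNReal.ofReal_le_ofReal (le_abs_self _)
  filter_upwards [h1.eventually_le_const hε, h2.eventually_le_const hε, self_mem_nhdsWithin]
    with t ht1 ht2 ht
  exact ⟨tsub_le_iff_right.2 ((hle t ht s hs).trans (by gcongr)),
    (hle s hs t ht).trans (by gcongr)⟩

end Curves

/-! ### Plaque chains that cover a curve -/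

section Covering

variable {n ν : ℕ} {M X : Type*} [MetricSpace M] [MetricSpace X] {A : Atlas n ν M X}
  {G : LeafMetric A} {εM lamF delFU : ℝ}

/-- The plaque chain `p` along `I` covers the path `γ` on `[a, b]`, with subdivision `s`; both
endpoints of `γ` lie in the open plaques at the ends of the chain, so that chains can be
prolonged. -/
def Atlas.ChainOn (A : Atlas n ν M X) (γ : ℝ → M) (a b : ℝ) {k : ℕ} (I : Fin (k + 1) → Fin ν)
    (p : Fin (k + 1) → X) (s : Fin (k + 1) → ℝ) : Prop :=
  A.IsPlaqueChain I p ∧ StrictMono s ∧ s 0 = a ∧ s (Fin.last k) = b ∧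
    (∀ l : Fin k,
      MapsTo γ (Icc (s l.castSucc) (s l.succ)) (A.plaque (I l.castSucc) (p l.castSucc))) ∧
    (γ a ∈ A.U (I 0) ∧ (A.chart (I 0) (γ a)).2 = p 0) ∧
    (γ b ∈ A.U (I (Fin.last k)) ∧ (A.chart (I (Fin.last k)) (γ b)).2 = p (Fin.last k))

theorem Atlas.chainOn_singleton {γ : ℝ → M} {b : ℝ} {w : X} (h : γ b = A.tau w) :
    A.ChainOn γ b b (fun _ : Fin 1 => A.idx w) (fun _ => w) (fun _ => b) := by
  have hU : γ b ∈ A.U (A.idx w) := h ▸ A.tau_mem_U w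
  have hc : (A.chart (A.idx w) (γ b)).2 = w := by rw [h, A.chart_tau]
  exact ⟨⟨rfl, fun l => l.elim0⟩, Fin.strictMono_iff_lt_succ.2 fun l => l.elim0, rfl, rfl,
    fun l => l.elim0,
    ⟨hU, hc⟩, ⟨hU, hc⟩⟩

theorem Atlas.ChainOn.cons [TotallyDisconnectedSpace X] {γ : ℝ → M} {a c b : ℝ} {k : ℕ}
    {I : Fin (k + 1) → Fin ν} {p : Fin (k + 1) → X} {s : Fin (k + 1) → ℝ}
    (h : A.ChainOn γ c b I p s) (hac : a < c) (hγ : ContinuousOn γ (Icc a c)) {i : Fin ν}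
    (hU : MapsTo γ (Icc a c) (A.U i)) :
    A.ChainOn γ a b (Fin.cons i I : Fin (k + 2) → Fin ν) (Fin.cons (A.chart i (γ a)).2 p)
      (Fin.cons a s) := by
  obtain ⟨⟨hp0, hp⟩, hs, hs0, hsl, hcov, ⟨hUc, hc⟩, hend⟩ := h
  have ha : a ∈ Icc a c := left_mem_Icc.2 hac.le
  have hconst : ∀ t ∈ Icc a c, (A.chart i (γ t)).2 = (A.chart i (γ a)).2 := fun t ht =>
    A.chart_snd_eq isPreconnected_Icc hγ hU ht ha
  refine ⟨⟨?_, fun l => ?_⟩, ?_, rfl, ?_, fun l => ?_, ⟨hU ha, rfl⟩, ?_⟩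
  · exact A.chart_snd_mem_T (hU ha).1
  · refine Fin.cases ?_ (fun l => ?_) l
    · have hcm : c ∈ Icc a c := right_mem_Icc.2 hac.le
      exact ⟨γ c, ⟨hU hcm, hUc⟩, hconst c hcm, hc⟩
    · simpa only [← Fin.succ_castSucc, Fin.cons_succ] using hp l
  · refine Fin.strictMono_iff_lt_succ.2 fun l => ?_
    refine Fin.cases ?_ (fun l => ?_) l
    · simpa [hs0] using hac
    · simpa only [← Fin.succ_castSucc, Fin.cons_succ] using hs l.castSucc_lt_succ
  · rw [← Fin.succ_last, Fin.cons_succ, hsl]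
  · refine Fin.cases ?_ (fun l => ?_) l
    · simp only [Fin.castSucc_zero, Fin.cons_zero, Fin.cons_succ, hs0]
      intro t ht
      have := A.mem_plaque_of_mem_U (hU ht)
      rwa [hconst t ht] at this
    · simpa only [← Fin.succ_castSucc, Fin.cons_succ] using hcov l
  · simpa only [← Fin.succ_last, Fin.cons_succ] using hend

variable {εU εFU : ℝ}

theorem exists_mapsTo_U_of_length_le (hεU : 0 < εU)
    (hLeb : ∀ z : M, ∃ i, Metric.ball z εU ⊆ A.U i)
    (hLebF : ∀ y : M, G.DF y εFU ⊆ Metric.closedBall y (εU / 4))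
    {γ : ℝ → M} {a b : ℝ} {x y : M} (hγ : A.IsCurve γ a b x y)
    (hl : G.length γ a b ≤ ENNReal.ofReal εFU) : ∃ i, MapsTo γ (Icc a b) (A.U i) := by
  obtain ⟨i, hi⟩ := hLeb (γ a)
  refine ⟨i, fun t ht => hi (Metric.closedBall_subset_ball (by linarith) (hLebF (γ a) ?_))⟩
  exact (LeafMetric.dF_le_length (hγ.restrict le_rfl ht.1 ht.2)).trans
    ((MeasureTheory.lintegral_mono_set (Icc_subset_Icc_right ht.2)).trans hl)

/-- A curve whose length is at most `m + 1` times the leafwise Lebesgue number is cut into at most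
`m + 1` arcs, each contained in one chart. -/
theorem exists_chainOn [TotallyDisconnectedSpace X] (hεU : 0 < εU) (hεFU : 0 < εFU)
    (hLeb : ∀ z : M, ∃ i, Metric.ball z εU ⊆ A.U i)
    (hLebF : ∀ y : M, G.DF y εFU ⊆ Metric.closedBall y (εU / 4))
    {γ : ℝ → M} {b : ℝ} {w : X} (m : ℕ) {a : ℝ} {x : M} (hab : a < b)
    (hγ : A.IsCurve γ a b x (A.tau w))
    (hl : G.length γ a b ≤ (m + 1 : ℕ) * ENNReal.ofReal εFU) :
    ∃ k ≤ m + 1, ∃ (I : Fin (k + 1) → Fin ν) (p : Fin (k + 1) → X) (s : Fin (k + 1) → ℝ),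
      A.ChainOn γ a b I p s ∧ p (Fin.last k) = w := by
  have hone : ∀ {a x}, a < b → A.IsCurve γ a b x (A.tau w) →
      G.length γ a b ≤ ENNReal.ofReal εFU →
      ∃ (I : Fin 2 → Fin ν) (p : Fin 2 → X) (s : Fin 2 → ℝ),
        A.ChainOn γ a b I p s ∧ p (Fin.last 1) = w := fun hab hγ hl => by
    obtain ⟨i, hi⟩ := exists_mapsTo_U_of_length_le hεU hLeb hLebF hγ hl
    exact ⟨_, _, _, (chainOn_singleton hγ.2.2.2.1).cons hab hγ.2.1 hi, rfl⟩
  induction m generalizing a x with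
  | zero => exact ⟨1, le_rfl, hone hab hγ (by simpa using hl)⟩
  | succ m ih =>
    by_cases hle : G.length γ a b ≤ ENNReal.ofReal εFU
    · exact ⟨1, by omega, hone hab hγ hle⟩
    rw [not_le] at hle
    have hfin : G.length γ a b ≠ ⊤ :=
      (hl.trans_lt (ENNReal.mul_lt_top (ENNReal.natCast_lt_top _) ENNReal.ofReal_lt_top)).ne
    have ha0 : G.length γ a a = 0 := by simp [LeafMetric.length]
    obtain ⟨c, hc, hcl⟩ := intermediate_value_Icc hab.le (LeafMetric.continuousOn_length hfin)
      (show ENNReal.ofReal εFU ∈ Icc (G.length γ a a) (G.length γ a b) from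
        ⟨by simp [ha0], hle.le⟩)
    simp only at hcl
    have hac : a < c := hc.1.lt_of_ne fun h => by
      rw [← h, ha0] at hcl
      exact (ENNReal.ofReal_pos.2 hεFU).ne hcl
    have hcb : c < b := hc.2.lt_of_ne fun h => by
      rw [h] at hcl
      exact hle.ne' hcl
    have hγ1 := hγ.restrict le_rfl hc.1 hc.2
    have hγ2 := hγ.restrict hc.1 hc.2 le_rfl
    rw [hγ.2.2.2.1] at hγ2
    have hl2 : G.length γ c b ≤ (m + 1 : ℕ) * ENNReal.ofReal εFU := by
      rw [← LeafMetric.length_add γ hc.1 hc.2, hcl, Nat.cast_succ (m + 1), add_mul, one_mul,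
        add_comm] at hl
      exact (ENNReal.add_le_add_iff_right ENNReal.ofReal_ne_top).1 hl
    obtain ⟨i, hi⟩ := exists_mapsTo_U_of_length_le hεU hLeb hLebF hγ1 hcl.le
    obtain ⟨k, hk, I, p, s, h, hw⟩ := ih hcb hγ2 hl2
    exact ⟨k + 1, by omega, _, _, _, h.cons hac hγ1.2.1 hi,
      by rw [← Fin.succ_last, Fin.cons_succ, hw]⟩

/-- For a curve that starts on the transversal, a short arc in the chart of the starting point is
put in front, so that the chain starts at the point itself. -/
theorem exists_chainOn_of_tau [TotallyDisconnectedSpace X] (hεU : 0 < εU) (hεFU : 0 < εFU)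
    (hLeb : ∀ z : M, ∃ i, Metric.ball z εU ⊆ A.U i)
    (hLebF : ∀ y : M, G.DF y εFU ⊆ Metric.closedBall y (εU / 4))
    {γ : ℝ → M} {a b : ℝ} {w w' : X} {m : ℕ} (hm : 1 ≤ m) (hab : a < b)
    (hγ : A.IsCurve γ a b (A.tau w) (A.tau w'))
    (hl : G.length γ a b ≤ ENNReal.ofReal (m * εFU)) :
    ∃ k ≤ m + 1, ∃ (I : Fin (k + 1) → Fin ν) (p : Fin (k + 1) → X) (s : Fin (k + 1) → ℝ),
      A.ChainOn γ a b I p s ∧ p 0 = w ∧ p (Fin.last k) = w' := by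
  have hU : γ ⁻¹' A.U (A.idx w) ∈ 𝓝[Icc a b] a :=
    (hγ.2.1 a (left_mem_Icc.2 hab.le)).preimage_mem_nhdsWithin
      ((A.isOpen_U _).mem_nhds (hγ.2.2.1 ▸ A.tau_mem_U w))
  obtain ⟨r, hr, hball⟩ := Metric.mem_nhdsWithin_iff.1 hU
  obtain ⟨c, hac, hcr⟩ := exists_between (lt_min (show a < a + r by linarith) hab)
  obtain ⟨hcr, hcb⟩ := lt_min_iff.1 hcr
  have hmaps : MapsTo γ (Icc a c) (A.U (A.idx w)) := fun t ht => hball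
    ⟨by rw [Metric.mem_ball, Real.dist_eq, abs_lt]; constructor <;> linarith [ht.1, ht.2],
      ht.1, ht.2.trans hcb.le⟩
  have hγ1 := hγ.restrict le_rfl hac.le hcb.le
  have hγ2 := hγ.restrict hac.le hcb.le le_rfl
  rw [hγ.2.2.2.1] at hγ2
  obtain ⟨m, rfl⟩ : ∃ m', m = m' + 1 := ⟨m - 1, by omega⟩
  have hl2 : G.length γ c b ≤ (m + 1 : ℕ) * ENNReal.ofReal εFU := by
    rw [ENNReal.ofReal_mul (Nat.cast_nonneg _), ENNReal.ofReal_natCast] at hl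
    exact (MeasureTheory.lintegral_mono_set (Icc_subset_Icc_left hac.le)).trans hl
  obtain ⟨k, hk, I, p, s, h, hw⟩ := exists_chainOn hεU hεFU hLeb hLebF m hcb hγ2 hl2
  refine ⟨k + 1, by omega, _, _, _, h.cons hac hγ1.2.1 hmaps, ?_, ?_⟩
  · rw [Fin.cons_zero, hγ.2.2.1, A.chart_tau]
  · rw [← Fin.succ_last, Fin.cons_succ, hw]

theorem IsRegular.exists_covers [TotallyDisconnectedSpace X] (hreg : IsRegular G εM lamF delFU)
    (hεU : 0 < εU) (hεFU : 0 < εFU)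
    (hLeb : ∀ z : M, ∃ i, Metric.ball z εU ⊆ A.U i)
    (hLebF : ∀ y : M, G.DF y εFU ⊆ Metric.closedBall y (εU / 4))
    {R : ℝ} (hR : 0 < R) {γ : ℝ → M} {w w' : X} (hγ : A.IsCurve γ 0 1 (A.tau w) (A.tau w'))
    (hl : G.length γ 0 1 ≤ ENNReal.ofReal R) :
    ∃ k ≤ ⌈R / εFU⌉₊ + 1, ∃ I : Fin (k + 1) → Fin ν,
      w ∈ A.holDom I ∧ A.hol I w = w' ∧ A.Covers I w γ := by
  have hm : 1 ≤ ⌈R / εFU⌉₊ := Nat.one_le_ceil_iff.2 (div_pos hR hεFU)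
  have hRm : R ≤ ⌈R / εFU⌉₊ * εFU := (div_le_iff₀ hεFU).1 (Nat.le_ceil _)
  obtain ⟨k, hk, I, p, s, h, rfl, rfl⟩ := exists_chainOn_of_tau hεU hεFU hLeb hLebF hm one_pos hγ
    (hl.trans (ENNReal.ofReal_le_ofReal hRm))
  obtain ⟨hp, hs, hs0, hsl, hcov, -, hend⟩ := h
  have hhol : A.HolTo I (p 0) (p (Fin.last k)) := ⟨p, hp, rfl, rfl⟩
  exact ⟨k, hk, I, hhol.mem_holDom, hreg.hol_eq hhol, p, s, hp, rfl, hs, hs0, hsl, hcov,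
    hend.2 ▸ A.mem_plaque_of_mem_U hend.1⟩

/-! ### The separation function -/

theorem IsRegular.exists_ball_separated [TotallyDisconnectedSpace X]
    (hreg : IsRegular G εM lamF delFU) (hεU : 0 < εU) (hεFU : 0 < εFU)
    (hLeb : ∀ z : M, ∃ i, Metric.ball z εU ⊆ A.U i)
    (hLebF : ∀ y : M, G.DF y εFU ⊆ Metric.closedBall y (εU / 4))
    {x : X} (hx : A.WithoutHolonomy x) {r : ℝ} (hr : 0 < r) :
    ∃ δ > 0, ∀ u ∈ Metric.ball x δ, ∀ v ∈ Metric.ball x δ, u ≠ v →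
      ENNReal.ofReal r ≤ G.dF (A.tau u) (A.tau v) := by
  obtain ⟨δ, hδ, h⟩ := hreg.exists_ball_hol_trivial hx (⌈r / εFU⌉₊ + 1)
  refine ⟨δ, hδ, fun u hu v hv huv => le_of_not_gt fun hlt => huv ?_⟩
  obtain ⟨γ, a, b, hγ, hl⟩ := LeafMetric.exists_curve_of_dF_lt hlt
  rcases hγ.1.eq_or_lt with rfl | hab
  · exact hreg.isometry_tau.injective (hγ.2.2.1.symm.trans hγ.2.2.2.1)
  have hm : 1 ≤ ⌈r / εFU⌉₊ := Nat.one_le_ceil_iff.2 (div_pos hr hεFU)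
  have hrm : r ≤ ⌈r / εFU⌉₊ * εFU := (div_le_iff₀ hεFU).1 (Nat.le_ceil _)
  obtain ⟨k, hk, I, p, s, hc, rfl, rfl⟩ := exists_chainOn_of_tau hεU hεFU hLeb hLebF hm hab hγ
    (hl.le.trans (ENNReal.ofReal_le_ofReal hrm))
  exact h k hk I _ hu _ hv ⟨p, hc.1, rfl, rfl⟩

theorem LeafMetric.le_lambdaAt [CompactSpace X] {x : X} {δ δ' : ℝ} (hδ : δ' < δ) {a : ℝ≥0∞}
    (h : ∀ u ∈ Metric.ball x δ, ∀ v ∈ Metric.ball x δ, u ≠ v → a ≤ G.dF (A.tau u) (A.tau v)) :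
    a ≤ G.lambdaAt x δ' := by
  refine le_iInf fun W => le_iInf fun _ => le_iInf fun hxW => le_iInf fun hW => le_iInf fun w =>
    le_iInf fun _ => le_sSup ?_
  have hball : W ⊆ Metric.ball x δ := fun u hu =>
    ((Metric.dist_le_diam_of_mem (Metric.isBounded_of_compactSpace) hu hxW).trans hW).trans_lt hδ
  rintro _ ⟨-, u, hu, rfl⟩ _ ⟨-, v, hv, rfl⟩ huv
  exact h u (hball hu) v (hball hv) fun h => huv (by rw [h])

/-- Small transverse scales have large leafwise separation, near a point without holonomy, and
uniformly if there is no holonomy at all. -/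
theorem IsRegular.exists_lt_lambda [CompactSpace X] [TotallyDisconnectedSpace X]
    (hreg : IsRegular G εM lamF delFU) (hεU : 0 < εU) (hεFU : 0 < εFU)
    (hLeb : ∀ z : M, ∃ i, Metric.ball z εU ⊆ A.U i)
    (hLebF : ∀ y : M, G.DF y εFU ⊆ Metric.closedBall y (εU / 4))
    {w₀ : X} (hw₀ : A.WithoutHolonomy w₀) {R : ℝ} (hR : 0 < R) :
    ∃ δ > 0, ∀ δ' < δ, ENNReal.ofReal R < G.lambdaAt w₀ δ' ∧
      ((∀ w, A.WithoutHolonomy w) → ENNReal.ofReal R < G.lambdaAll δ') := by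
  have hlt : ENNReal.ofReal R < ENNReal.ofReal (R + 1) :=
    (ENNReal.ofReal_lt_ofReal_iff (by linarith)).2 (by linarith)
  have hsep := fun {x : X} (hx : A.WithoutHolonomy x) =>
    hreg.exists_ball_separated hεU hεFU hLeb hLebF hx (show 0 < R + 1 by linarith)
  obtain ⟨δ₀, hδ₀, h₀⟩ := hsep hw₀
  by_cases hall : ∀ w, A.WithoutHolonomy w
  · choose d hd h using fun x => hsep (hall x)
    obtain ⟨δ₁, hδ₁, h₁⟩ := lebesgue_number_lemma_of_metric (isCompact_univ (X := X))
      (c := fun x => Metric.ball x (d x)) (fun x => Metric.isOpen_ball)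
      (fun x _ => mem_iUnion.2 ⟨x, Metric.mem_ball_self (hd x)⟩)
    refine ⟨min δ₀ δ₁, lt_min hδ₀ hδ₁, fun δ' hδ' => ?_⟩
    refine ⟨hlt.trans_le (LeafMetric.le_lambdaAt (hδ'.trans_le (min_le_left _ _)) h₀),
      fun _ => hlt.trans_le (le_iInf fun x => ?_)⟩
    obtain ⟨y, hy⟩ := h₁ x trivial
    exact LeafMetric.le_lambdaAt (hδ'.trans_le (min_le_right _ _)) fun u hu v hv =>
      h y u (hy hu) v (hy hv)
  · exact ⟨δ₀, hδ₀, fun δ' hδ' => ⟨hlt.trans_le (LeafMetric.le_lambdaAt hδ' h₀),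
      fun h => (hall h).elim⟩⟩

theorem LeafMetric.separated_lambdaAt {w₀ : X} {V : Set X} (hV : IsOpen V) (hw₀ : w₀ ∈ V) {ε : ℝ}
    (hdiam : Metric.diam V ≤ ε) : G.Separated (G.lambdaAt w₀ ε) (G.net w₀ V) := by
  intro y hy z hz hyz
  have h : G.lambdaAt w₀ ε ≤ sSup {a : ℝ≥0∞ | G.Separated a (G.net w₀ V)} :=
    iInf_le_of_le V (iInf_le_of_le hV (iInf_le_of_le hw₀ (iInf_le_of_le hdiam
      (iInf_le_of_le w₀ (iInf_le _ hw₀)))))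
  exact h.trans (sSup_le fun a ha => ha y hy z hz hyz)

/-! ### Density of the nets -/

/-- Inside a plaque the leafwise distance to the centre is at most `δ^F_U`, in both directions: a
shortest geodesic, which exists by strong convexity, realizes both distances. -/
theorem IsRegular.dF_tau_le (hreg : IsRegular G εM lamF delFU) {i : Fin ν} {w : X}
    (hw : w ∈ A.T i) {z : M} (hz : z ∈ A.plaque i w) :
    G.dF (A.tau w) z ≤ ENNReal.ofReal delFU ∧ G.dF z (A.tau w) ≤ ENNReal.ofReal delFU := by
  have h : G.dF (A.tau w) z ≤ ENNReal.ofReal delFU := (hreg.uniformity w i hw).2 hz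
  refine ⟨h, ?_⟩
  obtain rfl : A.idx w = i := hw
  obtain ⟨⟨c, ⟨h0, h1, hc⟩, -⟩, -⟩ :=
    hreg.convex_plaque w _ rfl (A.tau w) (A.tau_mem_plaque w) z hz
  have := hc 1 0
  rw [h0, h1] at this
  simpa [this] using h

theorem IsRegular.dF_le_of_meets (hreg : IsRegular G εM lamF delFU) {i j : Fin ν} {w w' : X}
    (h : A.Meets i j w w') : G.dF (A.tau w') (A.tau w) ≤ ENNReal.ofReal (2 * delFU) := by
  have h1 := h.left_mem
  have h2 := h.right_mem
  obtain ⟨z, ⟨hzi, hzj⟩, rfl, rfl⟩ := h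
  rw [two_mul, ENNReal.ofReal_add hreg.delFU_pos.le hreg.delFU_pos.le]
  exact (LeafMetric.dF_triangle _ z _).trans (add_le_add
    (hreg.dF_tau_le h2 (A.mem_plaque_of_mem_U hzj)).1
    (hreg.dF_tau_le h1 (A.mem_plaque_of_mem_U hzi)).2)

theorem IsRegular.dF_le_of_holTo (hreg : IsRegular G εM lamF delFU) {k : ℕ}
    {I : Fin (k + 1) → Fin ν} {u v : X} (h : A.HolTo I u v) :
    G.dF (A.tau v) (A.tau u) ≤ ENNReal.ofReal (2 * k * delFU) := by
  have hpos := hreg.delFU_pos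
  induction k generalizing v with
  | zero =>
    obtain ⟨-, rfl⟩ := holTo_zero.1 h
    simp [LeafMetric.dF_self]
  | succ k ih =>
    obtain ⟨v', h', hm⟩ := holTo_succ.1 h
    rw [show 2 * ((k + 1 : ℕ) : ℝ) * delFU = 2 * delFU + 2 * k * delFU by push_cast; ring,
      ENNReal.ofReal_add (by positivity) (by positivity)]
    exact (LeafMetric.dF_triangle _ (A.tau v') _).trans
      (add_le_add (hreg.dF_le_of_meets hm) (ih h'))

theorem IsRegular.denseIn_net (hreg : IsRegular G εM lamF delFU) {V : Set X} {α : ℕ}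
    (hα : A.CoveredByTranslates V α) (w₀ : X) :
    G.DenseIn ((2 * (α : ℝ) + 1) * delFU) (G.net w₀ V) (A.leaf (A.tau w₀)) := by
  intro x hx
  have hpos := hreg.delFU_pos
  obtain ⟨i, hi⟩ := A.exists_mem_U x
  have hT := A.chart_snd_mem_T hi.1
  have hP := A.mem_plaque_of_mem_U hi
  obtain ⟨k, hk, I, u, ⟨huV, hu⟩, huw⟩ := hα (A.chart i x).2
  have hhol := holTo_hol hu
  rw [huw] at hhol
  refine ⟨A.tau u, ⟨?_, u, huV, rfl⟩, (LeafMetric.dF_triangle _ (A.tau (A.chart i x).2) _).trans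
    ((add_le_add (hreg.dF_tau_le hT hP).2 (hreg.dF_le_of_holTo hhol)).trans ?_)⟩
  · exact (Joined.trans hx (A.joined_tau_of_mem_plaque hT hP).symm).trans (joined_of_holTo hhol).symm
  · rw [← ENNReal.ofReal_add hpos.le (by positivity)]
    refine ENNReal.ofReal_le_ofReal ?_
    have : (k : ℝ) ≤ α := Nat.cast_le.2 hk
    nlinarith

end Covering

/-! ### Clopen partitions -/

section Partition

variable {X : Type*} [MetricSpace X]

theorem diam_lt_of_subset_ball {S : Set X} {x : X} {r : ℝ} (hr : 0 < r)
    (h : S ⊆ Metric.ball x (r / 3)) : Metric.diam S < r :=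
  (Metric.diam_mono h Metric.isBounded_ball).trans_lt
    ((Metric.diam_ball (by positivity)).trans_lt (by linarith))

theorem exists_isClopen_subset_diam_lt [CompactSpace X] [TotallyDisconnectedSpace X] {x : X}
    {O : Set X} (hO : IsOpen O) (hx : x ∈ O) {r : ℝ} (hr : 0 < r) :
    ∃ V, IsClopen V ∧ x ∈ V ∧ V ⊆ O ∧ Metric.diam V < r := by
  obtain ⟨V, hV, hxV, hsub⟩ := compact_exists_isClopen_in_isOpen
    (hO.inter (Metric.isOpen_ball (x := x) (ε := r / 3)))
    ⟨hx, Metric.mem_ball_self (by positivity)⟩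
  exact ⟨V, hV, hxV, fun y hy => (hsub hy).1, diam_lt_of_subset_ball hr fun y hy => (hsub hy).2⟩

/-- A locally constant function with finitely many values cuts a clopen set into the nonempty ones
among its fibres. -/
theorem exists_isClopenPartition_fibers {F : Type*} [Finite F] {f : X → F}
    (hf : IsLocallyConstant f) {S : Set X} (hS : IsClopen S) :
    ∃ (κ : ℕ) (P : Fin κ → Set X), IsClopenPartition S P ∧
      (∀ j, ∀ u ∈ P j, ∀ v ∈ P j, f u = f v) ∧
      (∀ j j', j ≠ j' → ∀ u ∈ P j, ∀ v ∈ P j', f u ≠ f v) := by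
  obtain ⟨κ, ⟨g⟩⟩ := Finite.exists_equiv_fin (f '' S)
  have hne : ∀ j j', j ≠ j' → ∀ u ∈ S ∩ f ⁻¹' {(g.symm j : F)},
      ∀ v ∈ S ∩ f ⁻¹' {(g.symm j' : F)}, f u ≠ f v := by
    rintro j j' hj u ⟨-, hu⟩ v ⟨-, hv⟩ huv
    exact hj (g.symm.injective (Subtype.ext (hu.symm.trans (huv.trans hv))))
  refine ⟨κ, fun j => S ∩ f ⁻¹' {(g.symm j : F)}, ⟨fun j => hS.inter (hf.isClopen_fiber _),
    fun j => ?_, fun j j' hj => ?_, ?_⟩, ?_, hne⟩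
  · obtain ⟨u, hu, h⟩ := (g.symm j).2
    exact ⟨u, hu, h⟩
  · exact disjoint_left.2 fun u hu hu' => hne j j' hj u hu u hu' rfl
  · refine subset_antisymm (iUnion_subset fun j => inter_subset_left) fun u hu => ?_
    refine mem_iUnion.2 ⟨g ⟨f u, mem_image_of_mem f hu⟩, hu, ?_⟩
    simp
  · rintro j u ⟨-, hu⟩ v ⟨-, hv⟩
    exact Eq.trans hu (Eq.symm hv)

theorem exists_isClopenPartition_diam_lt [CompactSpace X] [TotallyDisconnectedSpace X] {S : Set X}
    (hS : IsClopen S) {r : ℝ} (hr : 0 < r) :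
    ∃ (κ : ℕ) (P : Fin κ → Set X), IsClopenPartition S P ∧ ∀ j, Metric.diam (P j) < r := by
  choose C hC hxC _ hdiam using fun x : X =>
    exists_isClopen_subset_diam_lt isOpen_univ (mem_univ x) hr
  obtain ⟨t, ht⟩ := CompactSpace.elim_nhds_subcover C fun x => (hC x).isOpen.mem_nhds (hxC x)
  -- The values of `f` record the members of the finite cover that contain a point.
  have hf : IsLocallyConstant fun (u : X) (x : t) => u ∈ C x := by
    refine (IsLocallyConstant.iff_eventually_eq _).2 fun u => ?_
    simp only [funext_iff, Filter.eventually_all]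
    intro x
    by_cases hu : u ∈ C x
    · filter_upwards [(hC x).isOpen.mem_nhds hu] with v hv
      simp [hu, hv]
    · filter_upwards [(hC x).compl.isOpen.mem_nhds hu] with v hv
      simpa [hu] using hv
  obtain ⟨κ, P, hP, hfP, -⟩ := exists_isClopenPartition_fibers hf hS
  refine ⟨κ, P, hP, fun j => ?_⟩
  obtain ⟨u, hu⟩ := hP.2.1 j
  have hut : u ∈ ⋃ x ∈ t, C x := by rw [ht]; trivial
  obtain ⟨x, hx, hux⟩ := mem_iUnion₂.1 hut
  refine (Metric.diam_mono (fun v hv => ?_) Metric.isBounded_of_compactSpace).trans_lt (hdiam x)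
  exact (congrFun (hfP j u hu v hv) ⟨x, hx⟩).mp hux

theorem exists_lt_dist_of_isClopen [CompactSpace X] {V : Set X} (hV : IsClopen V) :
    ∃ r > 0, ∀ e < r, ∀ x ∈ V, ∀ y ∉ V, e < dist x y := by
  obtain ⟨r, hr, h⟩ := hV.isClosed.isCompact.exists_thickening_subset_open hV.isOpen subset_rfl
  refine ⟨r, hr, fun e he x hx y hy => he.trans_le (le_of_not_gt fun hlt => hy (h ?_))⟩
  exact Metric.mem_thickening_iff.2 ⟨x, hx, by rwa [dist_comm]⟩

end Partition

/-! ### Codes -/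

section Codes

variable {n ν : ℕ} {M X : Type*} [MetricSpace M] [MetricSpace X] {A : Atlas n ν M X}
  {G : LeafMetric A} {εM lamF delFU : ℝ}

theorem code_eq_some_iff {κ : ℕ} {W : Fin κ → Set X}
    (hW : Pairwise fun i j => Disjoint (W i) (W j)) {k : ℕ} {I : Fin (k + 1) → Fin ν} {u : X}
    {m : Fin κ} : code A W I u = some m ↔ u ∈ A.holDom I ∧ A.hol I u ∈ W m := by
  unfold code
  split_ifs with h
  · rw [Option.some_inj]
    refine ⟨fun hm => hm ▸ h.choose_spec, fun hm => by_contra fun hne => ?_⟩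
    exact (hW hne).ne_of_mem h.choose_spec.2 hm.2 rfl
  · exact ⟨fun h => by simp at h, fun hm => (h ⟨m, hm⟩).elim⟩

theorem IsRegular.isLocallyConstant_code (hreg : IsRegular G εM lamF delFU) {V : Set X} {κ : ℕ}
    {W : Fin κ → Set X} (hW : IsClopenPartition V W) {k : ℕ} (I : Fin (k + 1) → Fin ν) :
    IsLocallyConstant (code A W I) := by
  have hsome : ∀ m, code A W I ⁻¹' {some m} = A.holDom I ∩ A.hol I ⁻¹' W m := fun m => by
    ext u
    exact code_eq_some_iff hW.2.2.1
  refine IsLocallyConstant.iff_isOpen_fiber.2 fun c => ?_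
  cases c with
  | some m =>
    rw [hsome m]
    exact (hreg.isClopen_preimage_hol I (hW.1 m)).isOpen
  | none =>
    have hnone : code A W I ⁻¹' {none} = (⋃ m, A.holDom I ∩ A.hol I ⁻¹' W m)ᶜ := by
      ext u
      simp only [← hsome, mem_preimage, mem_singleton_iff, mem_compl_iff, mem_iUnion,
        not_exists, Option.eq_none_iff_forall_ne_some]
    rw [hnone]
    exact (isClosed_iUnion_of_finite fun m =>
      (hreg.isClopen_preimage_hol I (hW.1 m)).isClosed).isOpen_compl

/-- Having the same codes along the finitely many chains of bounded length is equality of the values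
of one locally constant function, the list of all the codes. -/
theorem IsRegular.exists_isLocallyConstant_sameCode (hreg : IsRegular G εM lamF delFU) {V : Set X}
    {κ : ℕ} {W : Fin κ → Set X} (hW : IsClopenPartition V W) (i : Fin κ) (R : ℝ) (N : ℕ) :
    ∃ f : X → (Σ k : Fin (N + 1), (Fin ((k : ℕ) + 1) → Fin ν)) → Option (Fin κ),
      IsLocallyConstant f ∧ ∀ u v, SameCode G V W i R N u v ↔ f u = f v := by
  classical
  refine ⟨fun u J => if ∃ w ∈ W i, IsCodingChain G V R N J.2 w then code A W J.2 u else none,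
    ?_, fun u v => ⟨fun h => funext fun J => ?_, fun h w hw k I hI => ?_⟩⟩
  · refine (IsLocallyConstant.iff_eventually_eq _).2 fun u => ?_
    simp only [funext_iff, Filter.eventually_all]
    intro J
    filter_upwards [(hreg.isLocallyConstant_code hW J.2).eventually_eq u] with v hv
    rw [hv]
  · beta_reduce
    split_ifs with hJ
    · obtain ⟨w, hw, hJ⟩ := hJ
      exact h w hw _ _ hJ
    · rfl
  · have := congrFun h ⟨⟨k, Nat.lt_succ_of_le hI.1⟩, I⟩
    simpa only [if_pos (⟨w, hw, hI⟩ : ∃ w ∈ W i, IsCodingChain G V R N I w)] using this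

theorem IsRegular.exists_isClopenPartition_sameCode (hreg : IsRegular G εM lamF delFU) {V : Set X}
    {κ : ℕ} {W : Fin κ → Set X} (hW : IsClopenPartition V W) (i : Fin κ) (R : ℝ) (N : ℕ)
    {S : Set X} (hS : IsClopen S) :
    ∃ (κ' : ℕ) (P : Fin κ' → Set X), IsClopenPartition S P ∧
      (∀ j, ∀ u ∈ P j, ∀ v ∈ P j, SameCode G V W i R N u v) ∧
      (∀ j j', j ≠ j' → ∀ u ∈ P j, ∀ v ∈ P j', ¬ SameCode G V W i R N u v) := by
  obtain ⟨f, hf, h⟩ := hreg.exists_isLocallyConstant_sameCode hW i R N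
  simp only [h]
  exact exists_isClopenPartition_fibers hf hS

theorem IsDomainRadius.mapsTo_of_diam_lt [CompactSpace X] {e δ : ℝ} {N : ℕ}
    (hδ : IsDomainRadius A e N δ) {V : Set X} (he : ∀ x ∈ V, ∀ y ∉ V, e < dist x y) {S : Set X}
    (hS : Metric.diam S < δ) {R : ℝ} {k : ℕ} {I : Fin (k + 1) → Fin ν} {w : X} (hw : w ∈ S)
    (hI : IsCodingChain G V R N I w) : S ⊆ A.holDom I ∧ MapsTo (A.hol I) S V := by
  obtain ⟨hk, -, hwI, hwV, -⟩ := hI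
  obtain ⟨hdom, hmaps⟩ := hδ.2.2 k hk I w hwI
  have hball : S ⊆ Metric.closedBall w δ := fun u hu =>
    (Metric.dist_le_diam_of_mem Metric.isBounded_of_compactSpace hu hw).trans hS.le
  refine ⟨hball.trans hdom, fun u hu => by_contra fun hV => ?_⟩
  have := hmaps (hball hu)
  rw [Metric.mem_closedBall, dist_comm] at this
  exact (he _ hwV _ hV).not_ge this

end Codes

end Matchbox

/-! ### The inductive construction -/

theorem proposition6 {n ν : ℕ} {M X : Type*}
    [MetricSpace M] [CompactSpace M] [ConnectedSpace M]
    [MetricSpace X] [CompactSpace X] [TotallyDisconnectedSpace X]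
    (A : Matchbox.Atlas n ν M X) (G : Matchbox.LeafMetric A)
    -- the atlas is a regular foliated covering
    (εM lamF delFU : ℝ) (hreg : Matchbox.IsRegular G εM lamF delFU)
    -- the foliation is minimal
    (hmin : ∀ x : M, Dense (A.leaf x))
    -- a Lebesgue number and a leafwise Lebesgue number of the covering
    (εU εFU : ℝ) (hεU : 0 < εU) (hεFU : 0 < εFU)
    (hLeb : ∀ z : M, ∃ i, Metric.ball z εU ⊆ A.U i)
    (hLebF : ∀ y : M, G.DF y εFU ⊆ Metric.closedBall y (εU / 4))
    -- prescribed positive bounds on the transverse scales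
    (εH : ℝ) (hεH : 0 < εH)
    (δstar : Set X → ℕ → ℝ) (hδstar : ∀ V α, 0 < δstar V α)
    -- a base point whose leaf is without holonomy
    (w₀ : X) (hw₀ : A.WithoutHolonomy w₀) :
    ∃ (V : ℕ → Set X) (ε : ℕ → ℝ) (α : ℕ → ℕ) (θ R' R : ℕ → ℝ) (βhat : ℕ → ℕ)
      (e δhat : ℕ → ℝ)
      (κ : ℕ → ℕ) (W : ∀ ℓ, Fin (κ ℓ) → Set X)
      (κ₂ : ∀ ℓ, Fin (κ ℓ) → ℕ) (P : ∀ ℓ i, Fin (κ₂ ℓ i) → Set X)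
      (κ₃ : ∀ ℓ i, Fin (κ₂ ℓ i) → ℕ) (Q : ∀ ℓ i j, Fin (κ₃ ℓ i j) → Set X),
      ∀ ℓ : ℕ, 1 ≤ ℓ →
        -- (1) the nested clopen neighborhoods
        (IsClopen (V ℓ) ∧ w₀ ∈ V ℓ ∧ V ℓ ⊆ A.T (A.idx w₀) ∧ V (ℓ + 1) ⊆ V ℓ ∧
          Metric.diam (V ℓ) < εH / 2 ^ ℓ) ∧
        -- (2) the constants
        (0 < ε ℓ ∧ ε ℓ ≤ εH ∧ ε (ℓ + 1) < ε ℓ / 2 ∧ Metric.diam (V ℓ) < ε ℓ ∧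
          A.CoveredByTranslates (V ℓ) (α ℓ) ∧
          θ ℓ = (2 * (α ℓ : ℝ) + 1) * delFU ∧ R' ℓ = 2 * θ ℓ + lamF ∧ R ℓ = 2 * R' ℓ ∧
          βhat ℓ = ⌈R ℓ / εFU⌉₊ ∧
          0 < e ℓ ∧ e ℓ ≤ εH ∧ e ℓ ≤ δstar (V ℓ) (α ℓ) ∧
          (∀ x ∈ V ℓ, ∀ y ∉ V ℓ, e ℓ < dist x y) ∧
          Matchbox.IsDomainRadius A (e ℓ) (βhat ℓ + 1) (δhat ℓ) ∧
          ENNReal.ofReal (R ℓ) < G.lambdaAt w₀ (ε (ℓ + 1)) ∧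
          ((∀ w, A.WithoutHolonomy w) → ENNReal.ofReal (R ℓ) < G.lambdaAll (ε (ℓ + 1)))) ∧
        -- (3) the nets
        (G.Separated (G.lambdaAt w₀ (ε ℓ)) (G.net w₀ (V ℓ)) ∧
          G.DenseIn (θ ℓ) (G.net w₀ (V ℓ)) (A.leaf (A.tau w₀))) ∧
        -- (4) the clopen partition of `V ℓ`, and the coding functions are defined on its elements:
        -- paths of length at most `R ℓ` are covered by chains of length at most `βhat ℓ + 1`, and
        -- the holonomy of these chains is defined on the partition elements with values in `V ℓ`
        (Matchbox.IsClopenPartition (V ℓ) (W ℓ) ∧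
          (∀ i, Metric.diam (W ℓ i) < δhat ℓ) ∧
          (∀ w ∈ V ℓ, ∀ w' ∈ V ℓ, ∀ γ : ℝ → M, A.IsCurve γ 0 1 (A.tau w) (A.tau w') →
            G.length γ 0 1 ≤ ENNReal.ofReal (R ℓ) →
            ∃ k ≤ βhat ℓ + 1, ∃ I : Fin (k + 1) → Fin ν,
              w ∈ A.holDom I ∧ A.hol I w = w' ∧ A.Covers I w γ) ∧
          (∀ i, ∀ w ∈ W ℓ i, ∀ (k : ℕ) (I : Fin (k + 1) → Fin ν),
            Matchbox.IsCodingChain G (V ℓ) (R ℓ) (βhat ℓ + 1) I w →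
              W ℓ i ⊆ A.holDom I ∧ MapsTo (A.hol I) (W ℓ i) (V ℓ))) ∧
        -- (5) the clopen partition of each `W ℓ i`; the codes along paths of length at most `R' ℓ`
        -- are constant on its elements and distinguish them
        (∀ i, Matchbox.IsClopenPartition (W ℓ i) (P ℓ i) ∧
          (∀ j, Metric.diam (P ℓ i j) < min (δhat ℓ) (εH / 4 ^ ℓ)) ∧
          (∀ j, ∀ u ∈ P ℓ i j, ∀ v ∈ P ℓ i j,
            Matchbox.SameCode G (V ℓ) (W ℓ) i (R' ℓ) (βhat ℓ + 1) u v) ∧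
          (∀ j j', j ≠ j' → ∀ u ∈ P ℓ i j, ∀ v ∈ P ℓ i j',
            ¬ Matchbox.SameCode G (V ℓ) (W ℓ) i (R' ℓ) (βhat ℓ + 1) u v)) ∧
        -- (6) the clopen partition of each `P ℓ i j`; the codes along paths of length at most `R ℓ`
        -- are constant on its elements and distinguish them
        (∀ i j, Matchbox.IsClopenPartition (P ℓ i j) (Q ℓ i j) ∧
          (∀ k, ∀ u ∈ Q ℓ i j k, ∀ v ∈ Q ℓ i j k,
            Matchbox.SameCode G (V ℓ) (W ℓ) i (R ℓ) (βhat ℓ + 1) u v) ∧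
          (∀ k k', k ≠ k' → ∀ u ∈ Q ℓ i j k, ∀ v ∈ Q ℓ i j k',
            ¬ Matchbox.SameCode G (V ℓ) (W ℓ) i (R ℓ) (βhat ℓ + 1) u v) ∧
          (∀ k, w₀ ∈ Q ℓ i j k → V (ℓ + 1) ⊆ Q ℓ i j k)) := by
  have hw₀T : w₀ ∈ A.T (A.idx w₀) := rfl
  -- `Adm ℓ V ε` is what the construction needs to know about stage `ℓ`, and each stage yields the
  -- data of the theorem together with an admissible pair for the next stage.
  let Adm : ℕ → Set X → ℝ → Prop := fun ℓ V ε => IsClopen V ∧ w₀ ∈ V ∧ V ⊆ A.T (A.idx w₀) ∧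
    Metric.diam V < εH / 2 ^ ℓ ∧ 0 < ε ∧ ε ≤ εH ∧ Metric.diam V < ε
  have step : ∀ ℓ V ε, Adm ℓ V ε → ∃ (V' : Set X) (ε' : ℝ), Adm (ℓ + 1) V' ε' ∧
      V' ⊆ V ∧ ε' < ε / 2 ∧
      ∃ (α : ℕ) (R : ℝ) (e δhat : ℝ) (κ : ℕ) (W : Fin κ → Set X)
        (κ₂ : Fin κ → ℕ) (P : ∀ i, Fin (κ₂ i) → Set X)
        (κ₃ : ∀ i, Fin (κ₂ i) → ℕ) (Q : ∀ i j, Fin (κ₃ i j) → Set X),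
      (A.CoveredByTranslates V α ∧ R = 2 * (2 * ((2 * (α : ℝ) + 1) * delFU) + lamF) ∧
        0 < e ∧ e ≤ εH ∧ e ≤ δstar V α ∧ (∀ x ∈ V, ∀ y ∉ V, e < dist x y) ∧
        Matchbox.IsDomainRadius A e (⌈R / εFU⌉₊ + 1) δhat ∧
        ENNReal.ofReal R < G.lambdaAt w₀ ε' ∧
        ((∀ w, A.WithoutHolonomy w) → ENNReal.ofReal R < G.lambdaAll ε')) ∧
      (Matchbox.IsClopenPartition V W ∧ (∀ i, Metric.diam (W i) < δhat) ∧
        (∀ w ∈ V, ∀ w' ∈ V, ∀ γ : ℝ → M, A.IsCurve γ 0 1 (A.tau w) (A.tau w') →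
          G.length γ 0 1 ≤ ENNReal.ofReal R →
          ∃ k ≤ ⌈R / εFU⌉₊ + 1, ∃ I : Fin (k + 1) → Fin ν,
            w ∈ A.holDom I ∧ A.hol I w = w' ∧ A.Covers I w γ) ∧
        (∀ i, ∀ w ∈ W i, ∀ (k : ℕ) (I : Fin (k + 1) → Fin ν),
          Matchbox.IsCodingChain G V R (⌈R / εFU⌉₊ + 1) I w →
            W i ⊆ A.holDom I ∧ MapsTo (A.hol I) (W i) V)) ∧
      (∀ i, Matchbox.IsClopenPartition (W i) (P i) ∧
        (∀ j, Metric.diam (P i j) < min δhat (εH / 4 ^ ℓ)) ∧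
        (∀ j, ∀ u ∈ P i j, ∀ v ∈ P i j,
          Matchbox.SameCode G V W i (2 * ((2 * (α : ℝ) + 1) * delFU) + lamF)
            (⌈R / εFU⌉₊ + 1) u v) ∧
        (∀ j j', j ≠ j' → ∀ u ∈ P i j, ∀ v ∈ P i j',
          ¬ Matchbox.SameCode G V W i (2 * ((2 * (α : ℝ) + 1) * delFU) + lamF)
            (⌈R / εFU⌉₊ + 1) u v)) ∧
      (∀ i j, Matchbox.IsClopenPartition (P i j) (Q i j) ∧
        (∀ k, ∀ u ∈ Q i j k, ∀ v ∈ Q i j k,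
          Matchbox.SameCode G V W i R (⌈R / εFU⌉₊ + 1) u v) ∧
        (∀ k k', k ≠ k' → ∀ u ∈ Q i j k, ∀ v ∈ Q i j k',
          ¬ Matchbox.SameCode G V W i R (⌈R / εFU⌉₊ + 1) u v) ∧
        (∀ k, w₀ ∈ Q i j k → V' ⊆ Q i j k)) := by
    rintro ℓ V ε ⟨hV, hwV, hVT, -, hε, hεle, -⟩
    obtain ⟨α, hα⟩ := hreg.exists_coveredByTranslates hmin hV.isOpen hwV
    obtain ⟨R, hR⟩ : ∃ R, R = 2 * (2 * ((2 * (α : ℝ) + 1) * delFU) + lamF) := ⟨_, rfl⟩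
    have hRpos : 0 < R := by
      have := hreg.delFU_pos
      have := hreg.lamF_pos
      rw [hR]; positivity
    obtain ⟨r, hr, hVr⟩ := Matchbox.exists_lt_dist_of_isClopen hV
    obtain ⟨e, he, hemin⟩ := exists_between (lt_min hr (lt_min hεH (hδstar V α)))
    obtain ⟨her, hemin⟩ := lt_min_iff.1 hemin
    obtain ⟨heH, heδ⟩ := lt_min_iff.1 hemin
    obtain ⟨δhat, hδhat⟩ := hreg.exists_domainRadius he (⌈R / εFU⌉₊ + 1)
    have h4 : 0 < εH / 4 ^ ℓ := by positivity
    -- The elements of the first partition are already as small as those of the second one have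
    -- to be, so that the code classes need no further subdivision.
    obtain ⟨κ, W, hW, hWdiam⟩ :=
      Matchbox.exists_isClopenPartition_diam_lt hV (lt_min hδhat.1 h4)
    choose κ₂ P hP hPs hPd using fun i => hreg.exists_isClopenPartition_sameCode hW i
      (2 * ((2 * (α : ℝ) + 1) * delFU) + lamF) (⌈R / εFU⌉₊ + 1) (hW.1 i)
    choose κ₃ Q hQ hQs hQd using fun i j => hreg.exists_isClopenPartition_sameCode hW i
      R (⌈R / εFU⌉₊ + 1) ((hP i).1 j)
    obtain ⟨δ, hδ, hlam⟩ := hreg.exists_lt_lambda hεU hεFU hLeb hLebF hw₀ hRpos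
    obtain ⟨ε', hε', hε'min⟩ := exists_between (lt_min hδ (half_pos hε))
    obtain ⟨hε'δ, hε'ε⟩ := lt_min_iff.1 hε'min
    have hO : IsOpen (V ∩ ⋂ (i) (j) (k) (_ : w₀ ∈ Q i j k), Q i j k) :=
      hV.isOpen.inter (isOpen_iInter_of_finite fun i => isOpen_iInter_of_finite fun j =>
        isOpen_iInter_of_finite fun k => isOpen_iInter_of_finite fun _ => ((hQ i j).1 k).isOpen)
    have hwO : w₀ ∈ V ∩ ⋂ (i) (j) (k) (_ : w₀ ∈ Q i j k), Q i j k :=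
      ⟨hwV, by simp only [mem_iInter]; exact fun _ _ _ h => h⟩
    have h2 : 0 < εH / 2 ^ (ℓ + 1) := by positivity
    obtain ⟨V', hV', hwV', hsub, hdiam⟩ :=
      Matchbox.exists_isClopen_subset_diam_lt hO hwO (lt_min h2 hε')
    refine ⟨V', ε', ⟨hV', hwV', fun x hx => hVT (hsub hx).1, hdiam.trans_le (min_le_left _ _), hε',
      by linarith, hdiam.trans_le (min_le_right _ _)⟩, fun x hx => (hsub hx).1, hε'ε, α, R, e, δhat,
      κ, W, κ₂, P, κ₃, Q, ⟨hα, hR, he, heH.le, heδ.le, hVr e her, hδhat, hlam ε' hε'δ⟩,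
      ⟨hW, fun i => (hWdiam i).trans_le (min_le_left _ _),
        fun w _ w' _ γ hγ hl => hreg.exists_covers hεU hεFU hLeb hLebF hRpos hγ hl,
        fun i w hw k I hI => hδhat.mapsTo_of_diam_lt (hVr e her)
          ((hWdiam i).trans_le (min_le_left _ _)) hw hI⟩,
      fun i => ⟨hP i, fun j => ?_, hPs i, hPd i⟩,
      fun i j => ⟨hQ i j, hQs i j, hQd i j, fun k hk x hx => ?_⟩⟩
    · exact (Metric.diam_mono ((subset_iUnion _ j).trans (hP i).2.2.2.subset)
        Metric.isBounded_of_compactSpace).trans_lt (hWdiam i)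
    · have := (hsub hx).2
      simp only [mem_iInter] at this
      exact this i j k hk
  obtain ⟨V₀, hV₀, hwV₀, hVT₀, hdiam₀⟩ :=
    Matchbox.exists_isClopen_subset_diam_lt (A.isClopen_T _).isOpen hw₀T hεH
  choose! nextV nextε hnext hsub hlt hdata using step
  let s : ℕ → Set X × ℝ := fun ℓ =>
    Nat.rec (V₀, εH) (fun ℓ p => (nextV ℓ p.1 p.2, nextε ℓ p.1 p.2)) ℓ
  have hs : ∀ ℓ, Adm ℓ (s ℓ).1 (s ℓ).2 := by
    intro ℓ
    induction ℓ with
    | zero => exact ⟨hV₀, hwV₀, hVT₀, by rw [pow_zero, div_one]; exact hdiam₀, hεH, le_rfl, hdiam₀⟩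
    | succ ℓ ih => exact hnext _ _ _ ih
  choose α R e δhat κ W κ₂ P κ₃ Q h2 h4 h5 h6 using fun ℓ => hdata ℓ _ _ (hs ℓ)
  refine ⟨fun ℓ => (s ℓ).1, fun ℓ => (s ℓ).2, α, fun ℓ => (2 * (α ℓ : ℝ) + 1) * delFU,
    fun ℓ => 2 * ((2 * (α ℓ : ℝ) + 1) * delFU) + lamF, R, fun ℓ => ⌈R ℓ / εFU⌉₊, e, δhat, κ, W,
    κ₂, P, κ₃, Q, fun ℓ _ => ?_⟩
  obtain ⟨hV, hwV, hVT, hdiam, hε, hεle, hdiamε⟩ := hs ℓ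
  obtain ⟨hα, hR, he, heH, heδ, heV, hδ, hlam⟩ := h2 ℓ
  exact ⟨⟨hV, hwV, hVT, hsub _ _ _ (hs ℓ), hdiam⟩,
    ⟨hε, hεle, hlt _ _ _ (hs ℓ), hdiamε, hα, rfl, rfl, hR, rfl, he, heH, heδ, heV, hδ, hlam⟩,
    ⟨Matchbox.LeafMetric.separated_lambdaAt hV.isOpen hwV hdiamε.le, hreg.denseIn_net hα w₀⟩,
    h4 ℓ, h5 ℓ, h6 ℓ⟩
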